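/- Let $A,B$ be finite-dimensional quantum systems and let $\mathcal N_0\neq\mathcal N_1$ be two quantum channels (completely positive trace-preserving maps) from $A$ to $B$. All logarithms are natural unless a base is shown. **Divergences.** For states $\rho,\sigma$ put $D_{\max}(\rho\|\sigma)=\inf\{\gamma\in\mathbb R:\rho\le 2^{\gamma}\sigma\}$ ($=\infty$ if there is no such $\gamma$), and let $D_{\mathcal M}(\rho\|\sigma)$ be the supremum, over all projector-valued measures $\{m_y\}_{y\in\mathcal Y}$ with finitely many outcomes, of the relative entropy of the distribution $y\mapsto\mathrm{Tr}[\rho m_y]$ with respect to $y\mapsto\mathrm{Tr}[\sigma m_y]$. For channels put $D_{\bullet}(\mathcal N\|\mathcal M)=\sup_{\rho^{RA}}D_{\bullet}\big((\mathrm{id}_R\otimes\mathcal N)(\rho^{RA})\,\big\|\,(\mathrm{id}_R\otimes\mathcal M)(\rho^{RA})\big)$ for $\bullet\in\{\max,\mathcal M\}$, the supremum being over all finite-dimensional ancillas $R$ and all states $\rho^{RA}$. **Strategies.** An adaptive sequential strategy $\mathcal S$ consists of a finite-dimensional ancilla $R$, a finite alphabet $\mathcal Y$, a probability law $\nu_1$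 and conditional probability laws $\nu_k$ ($k\ge2$) of the pair $(\rho_k,M_k)$ (input state on $RA$, POVM on $RB$ with outcomes in $\mathcal Y$) given the full past $(\rho_j,M_j,Y_j)_{j<k}$, and measurable decision functions $d_k$ of $(\rho_j,M_j,Y_j)_{j\le k}$ with values in $\{0,1,*\}$. When the channel is $\mathcal N_i$, the outcome $Y_k$ has, given $\rho_k,M_k$ and the past, the distribution $y\mapsto\mathrm{Tr}[(\mathrm{id}_R\otimes\mathcal N_i)(\rho_k)M_k(y)]$; no quantum system is kept between rounds. Let $T$ be the first $k\ge1$ with $d_k\ne *$ ($T=\infty$ if there is none). For a sequence $(\mathcal S_n)_{n\in\mathbb N}$ of strategies with stopping times $T_n$, let $\mathbb P_{n,i},\mathbb E_{n,i}$ denote probability and expectation under $\mathcal S_n$ and $\mathcal N_i$, and put $\alpha_n=\mathbb P_{n,0}(T_n<\infty,\,d_{T_n}=1)$ and $\beta_n=\mathbb P_{n,1}(T_n<\infty,\,d_{T_n}=0)$. **Regions.** A pair $(R_0,R_1)\in(0,\infty)^2$ is achievable under the expectation constraint if some sequence $(\mathcal S_n)$ satisfies $$\liminf_{n\to\infty}\tfrac1n\log\tfrac1{\alpha_n}\ge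 R_0,\qquad \liminf_{n\to\infty}\tfrac1n\log\tfrac1{\beta_n}\ge R_1,\qquad \limsup_{n\to\infty}\big(\max_{i\in\{0,1\}}\mathbb E_{n,i}[T_n]-n\big)\le 0,$$ and $\varepsilon$-achievable under the probabilistic constraint if some sequence satisfies the first two conditions and $\limsup_{n\to\infty}\max_{i\in\{0,1\}}\mathbb P_{n,i}(T_n>n)<\varepsilon$. Let $\mathcal A_{\mathrm E}$ and $\mathcal A_{\mathrm P}(\varepsilon)$ be the closures in $\mathbb R^2$ of the respective sets of pairs. **Theorem.** If $\max_{i\in\{0,1\}}D_{\max}(\mathcal N_i\|\mathcal N_{1-i})<\infty$, then for every $\varepsilon\in(0,1)$ $$\mathcal A_{\mathrm P}(\varepsilon)=\mathcal A_{\mathrm E}=\{(R_0,R_1): 0\le R_0\le D_{\mathcal M}(\mathcal N_1\|\mathcal N_0),\ 0\le R_1\le D_{\mathcal M}(\mathcal N_0\|\mathcal N_1)\}.$$ -/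

import Mathlib

open MeasureTheory ProbabilityTheory Filter
open scoped ENNReal ComplexOrder

namespace ChannelDiscrimination

/-! ### States, measurements, channels

A finite-dimensional system is a finite type `D` labelling an orthonormal basis; operators on it are
`D × D` complex matrices, and the composite of `R` and `D` is `R × D`. -/

/-- A quantum state (density matrix). -/
structure State (D : Type*) [Fintype D] where
  mat : Matrix D D ℂ
  posSemidef : mat.PosSemidef
  trace_eq : mat.trace = 1

/-- A positive operator valued measure on `D` with outcomes in `Y`. -/
structure POVM (Y D : Type*) [Fintype Y] [Fintype D] [DecidableEq D] where
  elem : Y → Matrix D D ℂ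
  posSemidef : ∀ y, (elem y).PosSemidef
  sum_eq : ∑ y, elem y = 1

/-- A POVM is projector valued if each of its elements is a projector. -/
def POVM.IsProjective {Y D : Type*} [Fintype Y] [Fintype D] [DecidableEq D] (m : POVM Y D) : Prop :=
  ∀ y, m.elem y * m.elem y = m.elem y

/-- The Borel structure of the set of states, as a set of matrices. -/
noncomputable instance {D : Type*} [Fintype D] : MeasurableSpace (State D) :=
  MeasurableSpace.comap (fun (ρ : State D) (i j : D) => ρ.mat i j) inferInstance

/-- The Borel structure of the set of POVMs, as a set of families of matrices. -/
noncomputable instance {Y D : Type*} [Fintype Y] [Fintype D] [DecidableEq D] : MeasurableSpace (POVM Y D) :=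
  MeasurableSpace.comap (fun (m : POVM Y D) (y : Y) (i j : D) => m.elem y i j) inferInstance

section Channel

variable {A B : Type*}

/-- The map `id_R ⊗ N` on operators of the composite system: `N` acts on each block. -/
def ampl (N : Matrix A A ℂ →ₗ[ℂ] Matrix B B ℂ) (R : Type*) (X : Matrix (R × A) (R × A) ℂ) :
    Matrix (R × B) (R × B) ℂ :=
  fun p q => N (fun a a' => X (p.1, a) (q.1, a')) p.2 q.2

/-- A quantum channel from `A` to `B`: a completely positive trace-preserving linear map. -/
structure Channel (A B : Type*) [Fintype A] [Fintype B] where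
  map : Matrix A A ℂ →ₗ[ℂ] Matrix B B ℂ
  completelyPositive : ∀ (r : ℕ) (X : Matrix (Fin r × A) (Fin r × A) ℂ),
    X.PosSemidef → (ampl map (Fin r) X).PosSemidef
  tracePreserving : ∀ X : Matrix A A ℂ, (map X).trace = X.trace

variable [Fintype A] [Fintype B]

theorem Channel.trace_ampl (N : Channel A B) (r : ℕ) (X : Matrix (Fin r × A) (Fin r × A) ℂ) :
    (ampl N.map (Fin r) X).trace = X.trace := by
  simp only [Matrix.trace, Matrix.diag, Fintype.sum_prod_type]
  exact Finset.sum_congr rfl fun i _ => N.tracePreserving (fun a a' => X (i, a) (i, a'))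

/-- The output state `(id_R ⊗ N)(ρ)` of the channel, for an input state `ρ` on `R ⊗ A`. -/
def Channel.output (N : Channel A B) {r : ℕ} (ρ : State (Fin r × A)) : State (Fin r × B) where
  mat := ampl N.map (Fin r) ρ.mat
  posSemidef := N.completelyPositive r _ ρ.posSemidef
  trace_eq := (N.trace_ampl r ρ.mat).trans ρ.trace_eq

theorem measurable_output_entry (N : Channel A B) {r : ℕ} (p q : Fin r × B) :
    Measurable fun ρ : State (Fin r × A) => (N.output ρ).mat p q := by
  have h1 : Measurable fun (ρ : State (Fin r × A)) (i j : Fin r × A) => ρ.mat i j :=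
    comap_measurable _
  let L : (A → A → ℂ) →ₗ[ℂ] ℂ :=
    { toFun := fun X => N.map X p.2 q.2
      map_add' := fun X X' => congrFun (congrFun (N.map.map_add X X') p.2) q.2
      map_smul' := fun c X => congrFun (congrFun (N.map.map_smul c X) p.2) q.2 }
  have hL : Measurable L := (LinearMap.continuous_of_finiteDimensional L).measurable
  refine hL.comp (measurable_pi_lambda _ fun a => measurable_pi_lambda _ fun a' => ?_)
  exact (measurable_pi_apply _).comp ((measurable_pi_apply _).comp h1)

end Channel

/-! ### The outcome distribution -/

section Outcome

variable {D Y : Type*} [Fintype D] [DecidableEq D] [Fintype Y] [MeasurableSpace Y]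

/-- The distribution of the outcome of the measurement `m` in the state `ρ`:
the outcome `y` has probability `Tr[ρ m_y]`. -/
noncomputable def outcomeLaw (ρ : State D) (m : POVM Y D) : Measure Y :=
  ∑ y, ENNReal.ofReal (ρ.mat * m.elem y).trace.re • Measure.dirac y

open scoped MatrixOrder Matrix.Norms.L2Operator in
theorem trace_mul_re_nonneg {X Z : Matrix D D ℂ} (hX : X.PosSemidef) (hZ : Z.PosSemidef) :
    0 ≤ (X * Z).trace.re := by
  obtain ⟨C, hC⟩ := CStarAlgebra.nonneg_iff_eq_star_mul_self.mp hX.nonneg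
  rw [hC, Matrix.star_eq_conjTranspose]
  rw [Matrix.mul_assoc, Matrix.trace_mul_comm]
  exact (Complex.le_def.1 (hZ.mul_mul_conjTranspose_same C).trace_nonneg).1

instance (ρ : State D) (m : POVM Y D) : IsProbabilityMeasure (outcomeLaw ρ m) := by
  constructor
  simp only [outcomeLaw, Measure.coe_finsetSum, Measure.coe_smul, Finset.sum_apply, Pi.smul_apply,
    measure_univ, smul_eq_mul, mul_one]
  rw [← ENNReal.ofReal_sum_of_nonneg fun y _ => trace_mul_re_nonneg ρ.posSemidef (m.posSemidef y),
    ← Complex.re_sum, ← Matrix.trace_sum, ← Matrix.mul_sum, m.sum_eq, Matrix.mul_one, ρ.trace_eq]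
  simp

end Outcome

/-! ### Divergences (all logarithms in error exponents and relative entropies are natural) -/

section Divergence

/-- The max-divergence `inf {γ : ρ ≤ 2 ^ γ σ}` of two states (`⊤` if there is no such `γ`). -/
noncomputable def stateDmax {D : Type*} [Fintype D] (ρ σ : State D) : EReal :=
  ⨅ (γ : ℝ) (_ : (((2 : ℝ) ^ γ) • σ.mat - ρ.mat).PosSemidef), (γ : EReal)

/-- The measured relative entropy of two states: the supremum over all projector valued measures of
the relative entropy of the outcome distributions. -/
noncomputable def stateMeasuredDiv {D : Type*} [Fintype D] [DecidableEq D] (ρ σ : State D) : ℝ≥0∞ :=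
  ⨆ (k : ℕ) (m : POVM (Fin k) D) (_ : m.IsProjective),
    InformationTheory.klDiv (outcomeLaw ρ m) (outcomeLaw σ m)

variable {A B : Type*} [Fintype A] [Fintype B]

/-- The channel max-divergence: supremum over all ancillas and all bipartite input states. -/
noncomputable def channelDmax (N M : Channel A B) : EReal :=
  ⨆ (r : ℕ) (ρ : State (Fin r × A)), stateDmax (N.output ρ) (M.output ρ)

/-- The measured channel relative entropy: supremum over all ancillas and all bipartite input
states. -/
noncomputable def channelMeasuredDiv [DecidableEq B] (N M : Channel A B) : ℝ≥0∞ :=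
  ⨆ (r : ℕ) (ρ : State (Fin r × A)), stateMeasuredDiv (N.output ρ) (M.output ρ)

end Divergence

/-! ### Adaptive sequential strategies -/

section Strategy

variable {A B : Type*} [Fintype A] [Fintype B] [DecidableEq B]

/-- What the experimenter prepares in one round: an input state on `R ⊗ A` and a POVM on `R ⊗ B`. -/
abbrev Prep (A B : Type*) [Fintype A] [Fintype B] [DecidableEq B] (r k : ℕ) : Type _ :=
  State (Fin r × A) × POVM (Fin k) (Fin r × B)

/-- The record of one round: the preparation and the observed outcome. -/
abbrev Round (A B : Type*) [Fintype A] [Fintype B] [DecidableEq B] (r k : ℕ) : Type _ :=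
  Prep A B r k × Fin k

/-- The outcome of a round given the preparation, when the underlying channel is `N`. -/
noncomputable def outcomeKernel (N : Channel A B) (r k : ℕ) : Kernel (Prep A B r k) (Fin k) where
  toFun p := outcomeLaw (N.output p.1) p.2
  measurable' := by
    have h2 : Measurable fun (m : POVM (Fin k) (Fin r × B)) (y : Fin k) (i j : Fin r × B) =>
        m.elem y i j := comap_measurable _
    refine Measure.measurable_of_measurable_coe _ fun s _ => ?_
    simp only [outcomeLaw, Measure.coe_finsetSum, Measure.coe_smul, Finset.sum_apply,
      Pi.smul_apply, smul_eq_mul]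
    refine Finset.measurable_fun_sum _ fun y _ => Measurable.mul_const ?_ _
    refine ENNReal.measurable_ofReal.comp (Complex.measurable_re.comp ?_)
    simp only [Matrix.trace, Matrix.diag, Matrix.mul_apply]
    refine Finset.measurable_fun_sum _ fun p _ => Finset.measurable_fun_sum _ fun q _ => ?_
    refine ((measurable_output_entry N p q).comp measurable_fst).mul ?_
    exact (measurable_pi_apply p).comp ((measurable_pi_apply q).comp
      ((measurable_pi_apply y).comp (h2.comp measurable_snd)))

instance (N : Channel A B) (r k : ℕ) : IsMarkovKernel (outcomeKernel N r k) :=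
  ⟨fun p => inferInstanceAs (IsProbabilityMeasure (outcomeLaw (N.output p.1) p.2))⟩

/-- An adaptive sequential strategy without quantum memory. Rounds are numbered from `0`, so
`next n` and `decide n` see the complete records of the first `n + 1` rounds. -/
structure Strategy (A B : Type*) [Fintype A] [Fintype B] [DecidableEq B] where
  /-- dimension of the ancilla system `R` -/
  anc : ℕ
  /-- size of the outcome alphabet -/
  out : ℕ
  /-- law of the first input state and POVM -/
  first : Measure (Prep A B anc out)
  first_prob : IsProbabilityMeasure first
  /-- conditional law of the next input state and POVM, given the past -/
  next : (n : ℕ) → Kernel (Finset.Iic n → Round A B anc out) (Prep A B anc out)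
  next_markov : ∀ n, IsMarkovKernel (next n)
  /-- decision functions: `some i` stops and accepts hypothesis `i`, `none` continues -/
  decide : (n : ℕ) → (Finset.Iic n → Round A B anc out) → Option (Fin 2)
  measurableSet_decide : ∀ n v, MeasurableSet {h | decide n h = v}

namespace Strategy

variable (S : Strategy A B)

/-- Infinite records of the experiment (continued beyond the stopping time). -/
abbrev Path : Type _ := ℕ → Round A B S.anc S.out

/-- The law of the first round under the channel `N`. -/
noncomputable def firstRound (N : Channel A B) : Measure (Round A B S.anc S.out) :=
  S.first ⊗ₘ outcomeKernel N S.anc S.out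

/-- The law of the next round given the past, under the channel `N`. The outcome depends on the past
only through the current input state and POVM. -/
noncomputable def nextRound (N : Channel A B) (n : ℕ) :
    Kernel (Finset.Iic n → Round A B S.anc S.out) (Round A B S.anc S.out) :=
  S.next n ⊗ₖ (outcomeKernel N S.anc S.out).prodMkLeft (Finset.Iic n → Round A B S.anc S.out)

instance (N : Channel A B) (n : ℕ) : IsMarkovKernel (S.nextRound N n) := by
  have := S.next_markov n
  unfold nextRound
  infer_instance

/-- The law of the experiment when the underlying channel is `N`. -/
noncomputable def law (N : Channel A B) : Measure S.Path :=
  Kernel.trajMeasure (X := fun _ => Round A B S.anc S.out) (S.firstRound N) (S.nextRound N)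

instance (N : Channel A B) : IsProbabilityMeasure (S.law N) := by
  have := S.first_prob
  have : IsProbabilityMeasure (S.firstRound N) := by
    unfold firstRound
    infer_instance
  unfold law
  infer_instance

/-- The decision function after round `n`, evaluated along a path. -/
def decideAt (n : ℕ) (ω : S.Path) : Option (Fin 2) :=
  S.decide n (Preorder.frestrictLe (π := fun _ => Round A B S.anc S.out) n ω)

/-- The number `T` of channel uses (`⊤` if the procedure never stops). -/
noncomputable def time (ω : S.Path) : ℕ∞ :=
  ⨅ (n : ℕ) (_ : S.decideAt n ω ≠ none), ((n + 1 : ℕ) : ℕ∞)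

/-- The event that the procedure stops and accepts hypothesis `i`. -/
def accepts (i : Fin 2) : Set S.Path :=
  {ω | ∃ n : ℕ, S.time ω = ((n + 1 : ℕ) : ℕ∞) ∧ S.decideAt n ω = some i}

/-- The expected number of channel uses under the channel `N`. -/
noncomputable def expectedTime (N : Channel A B) : ℝ≥0∞ :=
  ∫⁻ ω, (S.time ω : ℝ≥0∞) ∂(S.law N)

/-- The probability under the channel `N` that more than `n` channel uses are made. -/
noncomputable def excessProb (N : Channel A B) (n : ℕ) : ℝ≥0∞ :=
  S.law N {ω | (n : ℕ∞) < S.time ω}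

end Strategy

/-- `liminf (1 / n) log (1 / e n)`, with `log (1 / 0) = ⊤`. -/
noncomputable def errorExponent (e : ℕ → ℝ≥0∞) : EReal :=
  liminf (fun n : ℕ => ENNReal.log (e n)⁻¹ / ((n : ℝ) : EReal)) atTop

/-- The sequence of strategies has error exponents at least `R.1` (for accepting hypothesis `1`
under `N₀`) and at least `R.2` (for accepting hypothesis `0` under `N₁`). -/
def HasExponents (N₀ N₁ : Channel A B) (S : ℕ → Strategy A B) (R : ℝ × ℝ) : Prop :=
  (R.1 : EReal) ≤ errorExponent (fun n => (S n).law N₀ ((S n).accepts 1)) ∧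
  (R.2 : EReal) ≤ errorExponent (fun n => (S n).law N₁ ((S n).accepts 0))

/-- The pairs of positive reals that are achievable under the expectation constraint. -/
def achievableE (N₀ N₁ : Channel A B) : Set (ℝ × ℝ) :=
  {R | 0 < R.1 ∧ 0 < R.2 ∧ ∃ S : ℕ → Strategy A B, HasExponents N₀ N₁ S R ∧
    limsup (fun n : ℕ =>
      ((max ((S n).expectedTime N₀) ((S n).expectedTime N₁) : ℝ≥0∞) : EReal) - ((n : ℝ) : EReal))
      atTop ≤ 0}

/-- The pairs of positive reals that are achievable under the `ε`-probabilistic constraint. -/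
def achievableP (ε : ℝ) (N₀ N₁ : Channel A B) : Set (ℝ × ℝ) :=
  {R | 0 < R.1 ∧ 0 < R.2 ∧ ∃ S : ℕ → Strategy A B, HasExponents N₀ N₁ S R ∧
    limsup (fun n : ℕ => max ((S n).excessProb N₀ n) ((S n).excessProb N₁ n)) atTop
      < ENNReal.ofReal ε}

/-- The error exponent region under the expectation constraint. -/
def regionE (N₀ N₁ : Channel A B) : Set (ℝ × ℝ) := closure (achievableE N₀ N₁)

/-- The error exponent region under the `ε`-probabilistic constraint. -/
def regionP (ε : ℝ) (N₀ N₁ : Channel A B) : Set (ℝ × ℝ) := closure (achievableP ε N₀ N₁)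

end Strategy

end ChannelDiscrimination

/-!
Why the theorem holds.

A finite `D_max` in both directions makes the outcome distributions `p`, `q` of the two channels
comparable, `p ≤ C q` and `q ≤ C p`, with one constant for all preparations
(`exists_uniformlyComparable`). All log-likelihood ratios are then bounded by `log C`, so that
`∑ p e ^ (s log (p / q)) ≤ e ^ (s D(p‖q) + O(s ^ 2))` uniformly (`Comparable.sum_mul_exp_le`).
Naimark's theorem, with the dilation absorbed into the ancilla, shows that `D(p‖q)` is at most the
measured channel divergence for every POVM and not only for projective ones
(`klDiv_outcomeLaw_le`).

*Converse.* With `a = s / (1 + s)`, Hölder's inequality gives, for one round and any function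
`g ≥ 0` of the outcome, `∑ p g ^ a ≤ κ (∑ q g) ^ a` with `κ = e ^ (a (D + O(s)))`. This bound
survives a random choice of the preparation and iterates along the history
(`lintegral_law_rpow_le`), whence `P_N(E) ≤ κ ^ m P_M(E) ^ a` for every event `E` of the first `m`
rounds. For the event that the procedure stops within `m` rounds and accepts the hypothesis of `N`,
the left-hand side stays away from zero, so that the error under `M` is at least about
`e ^ (-m (D + O(s)))` (`errorExponent_accepts_le`). Under the probabilistic constraint `m = n`; under
the expectation constraint Markov's inequality allows `m = (1 + η) n` for any `η > 0`.

*Achievability.* A short phase of rounds with a fixed preparation that distinguishes the channels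
yields a guess, by the sign of the log-likelihood ratio. Most of the rounds are then spent on
confirming the guess `i` with a preparation that is nearly optimal for `D(N_i‖N_j)`: under `N_i` the
log-likelihood ratio exceeds its threshold with high probability by Chernoff's bound
(`Comparable.exists_chernoff`), while under `N_j` it does so with probability at most
`e ^ (-threshold)`, because the likelihood ratio has mean one. In the unlikely case that the guess
is not confirmed, `K n` further rounds with the first preparation decide with both errors negligible.
The same strategies satisfy both constraints (`exists_strategy`, `exists_strategies`). Both
divergences are positive since distinct channels are distinguished by some preparation
(`exists_outProb_ne`), so the attained open rectangle is dense in the closed one.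
-/

namespace ChannelDiscrimination

/-! ### Two comparable distributions on a finite set -/

section Comparable

variable {ι : Type*} [Fintype ι]

/-- The relative entropy of two distributions on a finite set. The logarithm of a quotient with a
vanishing entry is `0`, which is harmless as long as both entries vanish together. -/
noncomputable def relEnt (p q : ι → ℝ) : ℝ := ∑ y, p y * Real.log (p y / q y)

/-- Two probability vectors each of which is at most `C` times the other. -/
structure Comparable (C : ℝ) (p q : ι → ℝ) : Prop where
  left_nonneg : ∀ y, 0 ≤ p y
  right_nonneg : ∀ y, 0 ≤ q y
  left_sum : ∑ y, p y = 1
  right_sum : ∑ y, q y = 1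
  left_le : ∀ y, p y ≤ C * q y
  right_le : ∀ y, q y ≤ C * p y

variable {C : ℝ} {p q : ι → ℝ}

namespace Comparable

theorem symm (h : Comparable C p q) : Comparable C q p :=
  ⟨h.right_nonneg, h.left_nonneg, h.right_sum, h.left_sum, h.right_le, h.left_le⟩

theorem one_le (h : Comparable C p q) : 1 ≤ C := by
  have := Finset.sum_le_sum fun y (_ : y ∈ Finset.univ) => h.left_le y
  rwa [h.left_sum, ← Finset.mul_sum, h.right_sum, mul_one] at this

theorem log_nonneg (h : Comparable C p q) : 0 ≤ Real.log C := Real.log_nonneg h.one_le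

theorem right_eq_zero (h : Comparable C p q) {y : ι} (hy : p y = 0) : q y = 0 :=
  le_antisymm (by simpa [hy] using h.right_le y) (h.right_nonneg y)

theorem eq_zero_iff (h : Comparable C p q) (y : ι) : p y = 0 ↔ q y = 0 :=
  ⟨h.right_eq_zero, h.symm.right_eq_zero⟩

theorem abs_log_le (h : Comparable C p q) (y : ι) : |Real.log (p y / q y)| ≤ Real.log C := by
  by_cases hp : p y = 0
  · simpa [hp] using h.log_nonneg
  have hq : q y ≠ 0 := fun h0 => hp ((h.eq_zero_iff y).2 h0)
  have hp' : 0 < p y := lt_of_le_of_ne (h.left_nonneg y) (Ne.symm hp)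
  have hq' : 0 < q y := lt_of_le_of_ne (h.right_nonneg y) (Ne.symm hq)
  have hC : 0 < C := zero_lt_one.trans_le h.one_le
  rw [abs_le]
  constructor
  · rw [← Real.log_inv]
    apply Real.log_le_log (inv_pos.2 hC)
    rw [inv_eq_one_div, div_le_div_iff₀ hC hq']
    linarith [h.right_le y]
  · apply Real.log_le_log (div_pos hp' hq')
    rw [div_le_iff₀ hq']
    exact h.left_le y

theorem relEnt_le (h : Comparable C p q) : relEnt p q ≤ Real.log C := by
  calc relEnt p q ≤ ∑ y, p y * Real.log C := Finset.sum_le_sum fun y _ =>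
        mul_le_mul_of_nonneg_left ((le_abs_self _).trans (h.abs_log_le y)) (h.left_nonneg y)
    _ = Real.log C := by rw [← Finset.sum_mul, h.left_sum, one_mul]

theorem mul_exp_log (h : Comparable C p q) (y : ι) :
    q y * Real.exp (Real.log (p y / q y)) = p y := by
  by_cases hp : p y = 0
  · simp [hp, h.right_eq_zero hp]
  have hq : q y ≠ 0 := fun h0 => hp ((h.eq_zero_iff y).2 h0)
  rw [Real.exp_log (div_pos (lt_of_le_of_ne (h.left_nonneg y) (Ne.symm hp))
    (lt_of_le_of_ne (h.right_nonneg y) (Ne.symm hq)))]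
  field_simp

theorem sum_mul_exp_log (h : Comparable C p q) :
    ∑ y, q y * Real.exp (Real.log (p y / q y)) = 1 := by
  simp only [h.mul_exp_log, h.left_sum]

/-- The moment generating function of the log-likelihood ratio near the origin: its mean is the
relative entropy, and its range is contained in `[-log C, log C]`. -/
theorem sum_mul_exp_le (h : Comparable C p q) {s : ℝ} (hs : |s| * Real.log C ≤ 1) :
    ∑ y, p y * Real.exp (s * Real.log (p y / q y))
      ≤ Real.exp (s * relEnt p q + s ^ 2 * Real.log C ^ 2) := by
  have hpt : ∀ y, Real.exp (s * Real.log (p y / q y))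
      ≤ 1 + s * Real.log (p y / q y) + s ^ 2 * Real.log C ^ 2 := by
    intro y
    have h1 : |s * Real.log (p y / q y)| ≤ |s| * Real.log C := by
      rw [abs_mul]
      exact mul_le_mul_of_nonneg_left (h.abs_log_le y) (abs_nonneg s)
    have h2 := (abs_le.1 (Real.abs_exp_sub_one_sub_id_le (h1.trans hs))).2
    have h3 : (s * Real.log (p y / q y)) ^ 2 ≤ s ^ 2 * Real.log C ^ 2 := by
      rw [mul_pow]
      exact mul_le_mul_of_nonneg_left (sq_le_sq' (abs_le.1 (h.abs_log_le y)).1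
        (abs_le.1 (h.abs_log_le y)).2) (sq_nonneg s)
    linarith
  calc ∑ y, p y * Real.exp (s * Real.log (p y / q y))
      ≤ ∑ y, p y * (1 + s * Real.log (p y / q y) + s ^ 2 * Real.log C ^ 2) :=
        Finset.sum_le_sum fun y _ => mul_le_mul_of_nonneg_left (hpt y) (h.left_nonneg y)
    _ = (∑ y, p y) * (1 + s ^ 2 * Real.log C ^ 2) + s * relEnt p q := by
        rw [relEnt, Finset.mul_sum, Finset.sum_mul, ← Finset.sum_add_distrib]
        exact Finset.sum_congr rfl fun y _ => by ring
    _ ≤ Real.exp (s * relEnt p q + s ^ 2 * Real.log C ^ 2) := by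
        rw [h.left_sum]
        linarith [Real.add_one_le_exp (s * relEnt p q + s ^ 2 * Real.log C ^ 2)]

/-- A sum of independent log-likelihood ratios stays below a level smaller than the mean with
exponentially small probability: the Chernoff factor `θ` of one summand. -/
theorem exists_chernoff (h : Comparable C p q) {τ : ℝ} (hτ : τ < relEnt p q) :
    ∃ s > 0, ∃ θ ∈ Set.Ioo (0 : ℝ) 1,
      ∑ y, p y * Real.exp (s * (τ - Real.log (p y / q y))) ≤ θ := by
  have hc := h.log_nonneg
  set c := Real.log C
  set δ := relEnt p q - τ with hδ
  have hδ0 : 0 < δ := sub_pos.2 hτ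
  -- `s` is small enough for the moment bound, and `s * c ^ 2 < δ`
  set s : ℝ := min 1 δ / (2 * (1 + c) ^ 2) with hs
  have hm : 0 < min 1 δ := lt_min one_pos hδ0
  have hs0 : 0 < s := by positivity
  have hseq : s * (2 * (1 + c) ^ 2) = min 1 δ := div_mul_cancel₀ _ (by positivity)
  have hm1 : min 1 δ ≤ 1 := min_le_left _ _
  have hm2 : min 1 δ ≤ δ := min_le_right _ _
  have hsc : s * c ≤ 1 := by nlinarith [mul_nonneg hs0.le hc, mul_nonneg hs0.le (sq_nonneg c)]
  have hsc2 : s * c ^ 2 < δ := by nlinarith [mul_nonneg hs0.le hc, mul_nonneg hs0.le (sq_nonneg c)]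
  refine ⟨s, hs0, Real.exp (-(s * δ) + s ^ 2 * c ^ 2), ⟨Real.exp_pos _, ?_⟩, ?_⟩
  · rw [Real.exp_lt_one_iff]
    nlinarith
  · have h1 := h.sum_mul_exp_le (s := -s) (by rwa [abs_neg, abs_of_pos hs0])
    calc ∑ y, p y * Real.exp (s * (τ - Real.log (p y / q y)))
        = Real.exp (s * τ) * ∑ y, p y * Real.exp (-s * Real.log (p y / q y)) := by
          rw [Finset.mul_sum]
          refine Finset.sum_congr rfl fun y _ => ?_
          rw [mul_sub, sub_eq_add_neg, Real.exp_add, neg_mul]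
          ring
      _ ≤ Real.exp (s * τ) * Real.exp (-s * relEnt p q + (-s) ^ 2 * c ^ 2) :=
          mul_le_mul_of_nonneg_left h1 (Real.exp_pos _).le
      _ = Real.exp (-(s * δ) + s ^ 2 * c ^ 2) := by
          rw [← Real.exp_add, hδ]
          ring_nf

/-- One round of the change of measure: Hölder's inequality bounds a fractional moment under `p` by
the mean under `q`, at the cost of a Rényi divergence of order `1 + s`. -/
theorem sum_mul_rpow_le (h : Comparable C p q) {s D : ℝ} (hs0 : 0 < s) (hs : s * Real.log C ≤ 1)
    (hD : relEnt p q ≤ D) (g : ι → ℝ≥0∞) :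
    ∑ y, ENNReal.ofReal (p y) * g y ^ (s / (1 + s))
      ≤ ENNReal.ofReal (Real.exp (s / (1 + s) * (D + s * Real.log C ^ 2)))
        * (∑ y, ENNReal.ofReal (q y) * g y) ^ (s / (1 + s)) := by
  set a := s / (1 + s) with ha
  have h1s : 0 < 1 + s := by positivity
  have ha0 : 0 < a := by positivity
  set l := fun y => Real.log (p y / q y)
  have hconj : (1 / a).HolderConjugate (1 + s) := by
    rw [Real.holderConjugate_iff]
    constructor
    · rw [ha, one_div_div, lt_div_iff₀ hs0]
      linarith
    · rw [ha]
      field_simp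
      ring
  -- Hölder's inequality for the factors `(q g) ^ a` and `p ^ (1 / (1 + s)) e ^ (a l)`
  have key := ENNReal.inner_le_Lp_mul_Lq Finset.univ
    (fun y => (ENNReal.ofReal (q y) * g y) ^ a)
    (fun y => ENNReal.ofReal (p y ^ (1 / (1 + s)) * Real.exp (a * l y))) hconj
  have e1 : ∀ y, (ENNReal.ofReal (q y) * g y) ^ a
      * ENNReal.ofReal (p y ^ (1 / (1 + s)) * Real.exp (a * l y))
      = ENNReal.ofReal (p y) * g y ^ a := by
    intro y
    rw [ENNReal.mul_rpow_of_nonneg _ _ ha0.le, mul_right_comm,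
      ENNReal.ofReal_rpow_of_nonneg (h.right_nonneg y) ha0.le,
      ← ENNReal.ofReal_mul (Real.rpow_nonneg (h.right_nonneg y) _)]
    congr 2
    have h2 : q y ^ a * Real.exp (a * l y) = p y ^ a := by
      rw [← h.mul_exp_log y, Real.mul_rpow (h.right_nonneg y) (Real.exp_pos _).le, ← Real.exp_mul,
        mul_comm a]
    calc q y ^ a * (p y ^ (1 / (1 + s)) * Real.exp (a * l y))
        = (q y ^ a * Real.exp (a * l y)) * p y ^ (1 / (1 + s)) := by ring
      _ = p y ^ a * p y ^ (1 / (1 + s)) := by rw [h2]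
      _ = p y := by
          rw [← Real.rpow_add_of_nonneg (h.left_nonneg y) ha0.le (by positivity)]
          have : a + 1 / (1 + s) = 1 := by rw [ha]; field_simp; ring
          rw [this, Real.rpow_one]
  have e2 : ∀ y, ((ENNReal.ofReal (q y) * g y) ^ a) ^ (1 / a) = ENNReal.ofReal (q y) * g y := by
    intro y
    rw [← ENNReal.rpow_mul, mul_one_div_cancel ha0.ne', ENNReal.rpow_one]
  have e3 : ∀ y, ENNReal.ofReal (p y ^ (1 / (1 + s)) * Real.exp (a * l y)) ^ (1 + s)
      = ENNReal.ofReal (p y * Real.exp (s * l y)) := by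
    intro y
    rw [ENNReal.ofReal_rpow_of_nonneg (mul_nonneg (Real.rpow_nonneg (h.left_nonneg y) _)
      (Real.exp_pos _).le) h1s.le, Real.mul_rpow (Real.rpow_nonneg (h.left_nonneg y) _)
      (Real.exp_pos _).le, ← Real.rpow_mul (h.left_nonneg y), one_div_mul_cancel h1s.ne',
      Real.rpow_one, ← Real.exp_mul]
    congr 3
    rw [ha]
    field_simp
  simp only [e1, e2, e3, one_div_one_div] at key
  refine key.trans ?_
  rw [mul_comm]
  refine mul_le_mul_left ?_ _
  rw [← ENNReal.ofReal_sum_of_nonneg fun y _ => mul_nonneg (h.left_nonneg y) (Real.exp_pos _).le,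
    ENNReal.ofReal_rpow_of_nonneg (Finset.sum_nonneg fun y _ =>
      mul_nonneg (h.left_nonneg y) (Real.exp_pos _).le) (by positivity)]
  refine ENNReal.ofReal_le_ofReal ?_
  calc (∑ y, p y * Real.exp (s * l y)) ^ (1 / (1 + s))
      ≤ Real.exp (s * D + s ^ 2 * Real.log C ^ 2) ^ (1 / (1 + s)) := by
        refine Real.rpow_le_rpow (Finset.sum_nonneg fun y _ =>
          mul_nonneg (h.left_nonneg y) (Real.exp_pos _).le) ?_ (by positivity)
        refine (h.sum_mul_exp_le (by rwa [abs_of_pos hs0])).trans (Real.exp_le_exp.2 ?_)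
        linarith [mul_le_mul_of_nonneg_left hD hs0.le]
    _ = Real.exp (a * (D + s * Real.log C ^ 2)) := by
        rw [← Real.exp_mul, ha]
        congr 1
        field_simp

end Comparable

end Comparable

/-! ### Outcome probabilities -/

section OutcomeLaw

variable {D Y : Type*} [Fintype D] [DecidableEq D] [Fintype Y]

/-- The probability `Tr[ρ m_y]` of the outcome `y`. -/
noncomputable def bornProb (ρ : State D) (m : POVM Y D) (y : Y) : ℝ :=
  (ρ.mat * m.elem y).trace.re

theorem bornProb_nonneg (ρ : State D) (m : POVM Y D) (y : Y) : 0 ≤ bornProb ρ m y :=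
  trace_mul_re_nonneg ρ.posSemidef (m.posSemidef y)

theorem sum_bornProb (ρ : State D) (m : POVM Y D) : ∑ y, bornProb ρ m y = 1 := by
  simp only [bornProb]
  rw [← Complex.re_sum, ← Matrix.trace_sum, ← Matrix.mul_sum, m.sum_eq, Matrix.mul_one, ρ.trace_eq,
    Complex.one_re]

theorem bornProb_le_mul {C : ℝ} {ρ σ : State D} (h : (C • σ.mat - ρ.mat).PosSemidef)
    (m : POVM Y D) (y : Y) : bornProb ρ m y ≤ C * bornProb σ m y := by
  have h1 := trace_mul_re_nonneg h (m.posSemidef y)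
  rw [Matrix.sub_mul, Matrix.smul_mul, Matrix.trace_sub, Matrix.trace_smul, Complex.sub_re,
    Complex.smul_re, smul_eq_mul] at h1
  simpa only [bornProb] using sub_nonneg.1 h1

variable [MeasurableSpace Y]

theorem lintegral_outcomeLaw (ρ : State D) (m : POVM Y D) [MeasurableSingletonClass Y]
    (f : Y → ℝ≥0∞) :
    ∫⁻ y, f y ∂(outcomeLaw ρ m) = ∑ y, ENNReal.ofReal (bornProb ρ m y) * f y := by
  rw [outcomeLaw, lintegral_finsetSum_measure]
  simp only [lintegral_smul_measure, lintegral_dirac, smul_eq_mul, bornProb]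

theorem outcomeLaw_singleton [MeasurableSingletonClass Y] (ρ : State D) (m : POVM Y D) (y : Y) :
    outcomeLaw ρ m {y} = ENNReal.ofReal (bornProb ρ m y) := by
  classical
  rw [← lintegral_indicator_one (measurableSet_singleton y), lintegral_outcomeLaw,
    Finset.sum_eq_single y]
  · simp
  · intro z _ hz
    simp [hz]
  · simp

theorem outcomeLaw_congr {D' : Type*} [Fintype D'] [DecidableEq D'] {ρ : State D} {m : POVM Y D}
    {ρ' : State D'} {m' : POVM Y D'} (h : bornProb ρ' m' = bornProb ρ m) :
    outcomeLaw ρ' m' = outcomeLaw ρ m := by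
  change ∑ y, ENNReal.ofReal (bornProb ρ' m' y) • Measure.dirac y
    = ∑ y, ENNReal.ofReal (bornProb ρ m y) • Measure.dirac y
  rw [h]

/-- The relative entropy of outcome distributions that are comparable is the finite sum. -/
theorem klDiv_outcomeLaw [MeasurableSingletonClass Y] {C : ℝ} {ρ σ : State D} {m : POVM Y D}
    (h : Comparable C (bornProb ρ m) (bornProb σ m)) :
    InformationTheory.klDiv (outcomeLaw ρ m) (outcomeLaw σ m)
      = ENNReal.ofReal (relEnt (bornProb ρ m) (bornProb σ m)) := by
  set f : Y → ℝ≥0∞ := fun y => ENNReal.ofReal (bornProb ρ m y / bornProb σ m y) with hf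
  have hfm : Measurable f := measurable_of_finite f
  have hd : outcomeLaw ρ m = (outcomeLaw σ m).withDensity f := by
    refine Measure.ext_of_singleton fun y => ?_
    rw [withDensity_apply _ (measurableSet_singleton y), lintegral_singleton, outcomeLaw_singleton,
      outcomeLaw_singleton, hf, mul_comm, ← ENNReal.ofReal_mul (bornProb_nonneg σ m y)]
    congr 1
    by_cases hy : bornProb σ m y = 0
    · rw [hy, zero_mul, (h.eq_zero_iff y).2 hy]
    · field_simp
  have hac : outcomeLaw ρ m ≪ outcomeLaw σ m := by
    rw [hd]
    exact withDensity_absolutelyContinuous _ _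
  have hllr : llr (outcomeLaw ρ m) (outcomeLaw σ m) =ᵐ[outcomeLaw ρ m]
      fun y => Real.log (bornProb ρ m y / bornProb σ m y) := by
    have h1 := Measure.rnDeriv_withDensity (outcomeLaw σ m) hfm
    rw [← hd] at h1
    filter_upwards [hac.ae_le h1] with y hy
    rw [llr, hy, hf, ENNReal.toReal_ofReal (div_nonneg (bornProb_nonneg ρ m y)
      (bornProb_nonneg σ m y))]
  have hint : Integrable (llr (outcomeLaw ρ m) (outcomeLaw σ m)) (outcomeLaw ρ m) :=
    (Integrable.of_finite (f := fun y => Real.log (bornProb ρ m y / bornProb σ m y))).congr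
      hllr.symm
  rw [InformationTheory.klDiv_of_ac_of_integrable hac hint, integral_congr_ae hllr]
  simp only [probReal_univ, add_sub_cancel_right]
  congr 1
  rw [integral_fintype Integrable.of_finite, relEnt]
  refine Finset.sum_congr rfl fun y _ => ?_
  rw [measureReal_def, outcomeLaw_singleton, ENNReal.toReal_ofReal (bornProb_nonneg ρ m y),
    smul_eq_mul]

end OutcomeLaw

/-! ### Enlarging the ancilla -/

section Embedding

open Matrix

theorem State.ext_mat {D : Type*} [Fintype D] {ρ σ : State D} (h : ρ.mat = σ.mat) : ρ = σ := by
  cases ρ; cases σ; cases h; rfl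

/-- The isometry that maps the basis vector `d` to the basis vector `φ d`. -/
def basisEmb {D D' : Type*} [DecidableEq D'] (φ : D → D') : Matrix D' D ℂ :=
  (1 : Matrix D' D' ℂ).submatrix id φ

theorem conjTranspose_basisEmb_mul {D D' : Type*} [DecidableEq D] [Fintype D'] [DecidableEq D']
    {φ : D → D'} (hφ : Function.Injective φ) : (basisEmb φ)ᴴ * basisEmb φ = 1 := by
  rw [basisEmb, conjTranspose_submatrix, conjTranspose_one,
    ← submatrix_mul _ _ φ id φ Function.bijective_id, one_mul, submatrix_one _ hφ]

theorem mul_basisEmb {Z D D' : Type*} [Fintype D'] [DecidableEq D'] (W : Matrix Z D' ℂ)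
    (φ : D → D') : W * basisEmb φ = W.submatrix id φ := by
  have h := submatrix_mul W (1 : Matrix D' D' ℂ) id id φ Function.bijective_id
  rw [Matrix.mul_one, submatrix_id_id] at h
  exact h.symm

/-- The isometry of the composite system with `D` induced by the isometry of the ancillas that maps
the basis vector `i` to the basis vector `e i`. -/
abbrev ancEmb {R R' : Type*} [DecidableEq R'] (D : Type*) [DecidableEq D] (e : R → R') :
    Matrix (R' × D) (R × D) ℂ :=
  basisEmb (Prod.map e id)

theorem conjTranspose_ancEmb_mul {R R' D : Type*} [Fintype R'] [DecidableEq R] [DecidableEq R']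
    [Fintype D] [DecidableEq D] {e : R → R'} (he : Function.Injective e) :
    (ancEmb D e)ᴴ * ancEmb D e = 1 :=
  conjTranspose_basisEmb_mul (he.prodMap Function.injective_id)

theorem ancEmb_conj_apply {R R' D : Type*} [Fintype R] [DecidableEq R'] [Fintype D] [DecidableEq D]
    (e : R → R') (X : Matrix (R × D) (R × D) ℂ) (p q : R' × D) :
    (ancEmb D e * X * (ancEmb D e)ᴴ) p q
      = ∑ j, ∑ i, ((if p.1 = e i then 1 else 0) * (if q.1 = e j then 1 else 0))
        * X (i, p.2) (j, q.2) := by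
  obtain ⟨p, a⟩ := p
  obtain ⟨q, b⟩ := q
  simp only [mul_apply, basisEmb, submatrix_apply, id, conjTranspose_apply, Fintype.sum_prod_type,
    one_apply, Prod.map_apply, Prod.mk.injEq, ite_and, Finset.sum_mul]
  refine Finset.sum_congr rfl fun j _ => ?_
  by_cases hq : q = e j <;> by_cases hi : ∃ i, p = e i <;> simp [hq, Finset.sum_ite_eq, apply_ite]

section Conj

variable {D D' : Type*} [Fintype D] [DecidableEq D] [Fintype D']

/-- The image of a state under an isometry. -/
def State.conj (ρ : State D) (V : Matrix D' D ℂ) (hV : Vᴴ * V = 1) : State D' where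
  mat := V * ρ.mat * Vᴴ
  posSemidef := ρ.posSemidef.mul_mul_conjTranspose_same V
  trace_eq := by rw [trace_mul_comm, ← Matrix.mul_assoc, hV, Matrix.one_mul, ρ.trace_eq]

theorem bornProb_conj {Y : Type*} [Fintype Y] [DecidableEq D'] (ρ : State D) {V : Matrix D' D ℂ}
    (hV : Vᴴ * V = 1) {m : POVM Y D} {m' : POVM Y D'} (h : ∀ y, Vᴴ * m'.elem y * V = m.elem y) :
    bornProb (ρ.conj V hV) m' = bornProb ρ m := by
  funext y
  rw [bornProb, bornProb, ← h y]
  congr 1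
  change (V * ρ.mat * Vᴴ * m'.elem y).trace = _
  rw [Matrix.mul_assoc, Matrix.mul_assoc, trace_mul_comm, Matrix.mul_assoc, ← Matrix.mul_assoc]

end Conj

variable {A B : Type*} [Fintype A] [Fintype B] [DecidableEq A] [DecidableEq B]

/-- A channel acts on the system only, so it commutes with an isometry of the ancilla. -/
theorem Channel.output_conj (N : Channel A B) {r r' : ℕ} {e : Fin r → Fin r'}
    (he : Function.Injective e) (ρ : State (Fin r × A)) :
    N.output (ρ.conj (ancEmb A e) (conjTranspose_ancEmb_mul he))
      = (N.output ρ).conj (ancEmb B e) (conjTranspose_ancEmb_mul he) := by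
  apply State.ext_mat
  funext p q
  change ampl N.map (Fin r') (ancEmb A e * ρ.mat * (ancEmb A e)ᴴ) p q
    = (ancEmb B e * ampl N.map (Fin r) ρ.mat * (ancEmb B e)ᴴ) p q
  rw [ancEmb_conj_apply]
  have h1 : (Matrix.of fun a a' => (ancEmb A e * ρ.mat * (ancEmb A e)ᴴ) (p.1, a) (q.1, a'))
      = ∑ j, ∑ i, (((if p.1 = e i then 1 else 0) * (if q.1 = e j then 1 else 0) : ℂ)) •
          (Matrix.of fun a a' => ρ.mat (i, a) (j, a')) := by
    ext a a'
    simp only [Matrix.of_apply, ancEmb_conj_apply, Matrix.sum_apply, Matrix.smul_apply, smul_eq_mul]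
  change N.map (Matrix.of fun a a' => (ancEmb A e * ρ.mat * (ancEmb A e)ᴴ) (p.1, a) (q.1, a'))
    p.2 q.2 = _
  rw [h1]
  simp only [map_sum, map_smul, Matrix.sum_apply, Matrix.smul_apply, smul_eq_mul]
  rfl

end Embedding

/-! ### Projective dilations -/

section Naimark

open Matrix

/-- The projector onto the span of the basis vectors `z` with label `c z = y`. -/
def labelProj {Z Y : Type*} [DecidableEq Z] [DecidableEq Y] (c : Z → Y) (y : Y) : Matrix Z Z ℂ :=
  diagonal fun z => if c z = y then 1 else 0

theorem sum_labelProj {Z Y : Type*} [DecidableEq Z] [Fintype Y] [DecidableEq Y] (c : Z → Y) :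
    ∑ y, labelProj c y = 1 := by
  ext i j
  simp only [Matrix.sum_apply, labelProj, diagonal_apply, one_apply]
  split_ifs <;> simp

variable {D : Type*} [Fintype D] [DecidableEq D]

/-- The measurement that applies an isometry `W` and reads off the label `c z` of the basis
vector `z`. -/
def POVM.ofIsometry {Z Y : Type*} [Fintype Z] [DecidableEq Z] [Fintype Y] [DecidableEq Y]
    (W : Matrix Z D ℂ) (hW : Wᴴ * W = 1) (c : Z → Y) : POVM Y D where
  elem y := Wᴴ * labelProj c y * W
  posSemidef y := by
    refine PosSemidef.conjTranspose_mul_mul_same (PosSemidef.diagonal fun z => ?_) W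
    dsimp only
    split_ifs <;> simp
  sum_eq := by
    rw [← Matrix.sum_mul, ← Matrix.mul_sum, sum_labelProj, Matrix.mul_one, hW]

theorem POVM.isProjective_ofIsometry {Z Y : Type*} [Fintype Z] [DecidableEq Z] [Fintype Y]
    [DecidableEq Y] (W : Matrix Z D ℂ) (hW : Wᴴ * W = 1) (hW' : W * Wᴴ = 1) (c : Z → Y) :
    (POVM.ofIsometry W hW c).IsProjective := by
  intro y
  change Wᴴ * labelProj c y * W * (Wᴴ * labelProj c y * W) = Wᴴ * labelProj c y * W
  have h1 : Wᴴ * labelProj c y * W * (Wᴴ * labelProj c y * W)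
      = Wᴴ * (labelProj c y * (W * Wᴴ) * labelProj c y) * W := by
    simp only [Matrix.mul_assoc]
  rw [h1, hW', Matrix.mul_one, labelProj, diagonal_mul_diagonal]
  congr 3
  funext z
  simp

open scoped MatrixOrder Matrix.Norms.L2Operator in
/-- Every POVM is given by the isometry `v ↦ (√m_y v)_y`, followed by reading off `y`. -/
theorem POVM.exists_isometry {Y : Type*} [Fintype Y] [DecidableEq Y] (m : POVM Y D) :
    ∃ V : Matrix (Y × D) D ℂ, Vᴴ * V = 1 ∧
      ∀ y, Vᴴ * labelProj (Prod.fst : Y × D → Y) y * V = m.elem y := by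
  have hs : ∀ y, ∃ C : Matrix D D ℂ, m.elem y = Cᴴ * C := fun y => by
    obtain ⟨C, hC⟩ := CStarAlgebra.nonneg_iff_eq_star_mul_self.mp (m.posSemidef y).nonneg
    exact ⟨C, hC⟩
  choose C hC using hs
  refine ⟨Matrix.of fun z d => C z.1 z.2 d, ?_, fun y => ?_⟩
  · rw [← m.sum_eq]
    simp only [hC]
    ext i j
    simp [mul_apply, Fintype.sum_prod_type, Matrix.sum_apply]
  · rw [hC]
    ext i j
    rw [labelProj, Matrix.mul_assoc, mul_apply, Fintype.sum_prod_type, Finset.sum_eq_single y,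
      mul_apply]
    · simp [diagonal_mul]
    · intro z _ hz
      simp [hz]
    · simp

/-- An isometry is a corner of a unitary on the direct sum of its domain and its codomain. -/
theorem exists_unitary_dilation {K : Type*} [Fintype K] [DecidableEq K] (V : Matrix K D ℂ)
    (hV : Vᴴ * V = 1) : ∃ W : Matrix (K ⊕ D) (D ⊕ K) ℂ, Wᴴ * W = 1 ∧ W * Wᴴ = 1 ∧
      W.submatrix id Sum.inl = fromRows V 0 := by
  refine ⟨fromBlocks V (1 - V * Vᴴ) 0 Vᴴ, ?_, ?_, ?_⟩
  · rw [fromBlocks_conjTranspose, fromBlocks_multiply, ← fromBlocks_one]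
    congr 1 <;> simp [Matrix.mul_sub, Matrix.sub_mul, Matrix.mul_assoc, hV] <;>
      simp [← Matrix.mul_assoc, hV]
  · rw [fromBlocks_conjTranspose, fromBlocks_multiply, ← fromBlocks_one]
    congr 1 <;> simp [Matrix.mul_sub, Matrix.sub_mul, Matrix.mul_assoc, hV] <;>
      simp [← Matrix.mul_assoc, hV]
  · ext i j
    cases i <;> simp

/-- Naimark's theorem in the form needed for composite systems: every POVM on `R ⊗ D` is the
compression of a projective measurement on `R' ⊗ D` with a larger ancilla `R'`. -/
theorem POVM.exists_projective_dilation {r k : ℕ} (m : POVM (Fin k) (Fin r × D)) :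
    ∃ (r' : ℕ) (e : Fin r → Fin r') (_ : Function.Injective e)
      (m' : POVM (Fin k) (Fin r' × D)), m'.IsProjective ∧
      ∀ y, (ancEmb D e)ᴴ * m'.elem y * ancEmb D e = m.elem y := by
  obtain ⟨V, hV, hVm⟩ := m.exists_isometry
  obtain ⟨W, hW, hW', hWV⟩ := exists_unitary_dilation V hV
  rcases Nat.eq_zero_or_pos k with rfl | hk
  · refine ⟨r, id, Function.injective_id, m, fun y => y.elim0, fun y => y.elim0⟩
  let f : Fin r ⊕ (Fin k × Fin r) ≃ Fin (r + k * r) :=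
    (Equiv.sumCongr (Equiv.refl _) finProdFinEquiv).trans finSumFinEquiv
  let ψ : (Fin r × D) ⊕ (Fin k × (Fin r × D)) ≃ Fin (r + k * r) × D :=
    (Equiv.sumCongr (Equiv.refl _) (Equiv.prodAssoc _ _ _).symm).trans
      ((Equiv.sumProdDistrib _ _ _).symm.trans (Equiv.prodCongr f (Equiv.refl _)))
  let c : (Fin k × (Fin r × D)) ⊕ (Fin r × D) → Fin k := Sum.elim Prod.fst fun _ => ⟨0, hk⟩
  have hU : (W.submatrix id ψ.symm)ᴴ * W.submatrix id ψ.symm = 1 := by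
    rw [conjTranspose_submatrix, ← submatrix_mul _ _ ψ.symm id ψ.symm Function.bijective_id, hW,
      submatrix_one_equiv]
  have hU' : W.submatrix id ψ.symm * (W.submatrix id ψ.symm)ᴴ = 1 := by
    rw [conjTranspose_submatrix, ← submatrix_mul _ _ id ψ.symm id ψ.symm.bijective, hW',
      submatrix_id_id]
  refine ⟨r + k * r, f ∘ Sum.inl, f.injective.comp Sum.inl_injective, POVM.ofIsometry _ hU c,
    POVM.isProjective_ofIsometry _ hU hU' c, fun y => ?_⟩
  have h1 : W.submatrix id ψ.symm * ancEmb D (f ∘ Sum.inl) = fromRows V 0 := by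
    rw [ancEmb, mul_basisEmb, ← hWV, submatrix_submatrix]
    congr 1
    funext z
    rw [Function.comp_apply, Equiv.symm_apply_eq]
    rfl
  change (ancEmb D (f ∘ Sum.inl))ᴴ * ((W.submatrix id ψ.symm)ᴴ * labelProj c y
    * W.submatrix id ψ.symm) * ancEmb D (f ∘ Sum.inl) = m.elem y
  have h2 : (ancEmb D (f ∘ Sum.inl))ᴴ * ((W.submatrix id ψ.symm)ᴴ * labelProj c y
      * W.submatrix id ψ.symm) * ancEmb D (f ∘ Sum.inl)
      = (W.submatrix id ψ.symm * ancEmb D (f ∘ Sum.inl))ᴴ * labelProj c y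
        * (W.submatrix id ψ.symm * ancEmb D (f ∘ Sum.inl)) := by
    rw [conjTranspose_mul]
    simp only [Matrix.mul_assoc]
  rw [h2, h1, ← hVm y]
  ext i j
  simp [mul_apply, labelProj, Fintype.sum_sum_type, diagonal_apply, c]
  rfl

end Naimark

/-! ### Single rounds: the two channels on one preparation -/

section SingleRound

open Matrix

variable {A B : Type*} [Fintype A] [Fintype B] [DecidableEq B]

/-- The probability of the outcome `y` of a round with preparation `x` under the channel `N`. -/
noncomputable def outProb (N : Channel A B) {r k : ℕ} (x : Prep A B r k) : Fin k → ℝ :=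
  bornProb (N.output x.1) x.2

theorem outProb_nonneg (N : Channel A B) {r k : ℕ} (x : Prep A B r k) (y : Fin k) :
    0 ≤ outProb N x y := bornProb_nonneg _ _ _

theorem lintegral_outcomeKernel (N : Channel A B) {r k : ℕ} (x : Prep A B r k)
    (f : Fin k → ℝ≥0∞) :
    ∫⁻ y, f y ∂(outcomeKernel N r k x) = ∑ y, ENNReal.ofReal (outProb N x y) * f y :=
  lintegral_outcomeLaw (N.output x.1) x.2 f

/-- The two channels have outcome distributions that are comparable with the constant `C`, whatever
the preparation. -/
def UniformlyComparable (C : ℝ) (N M : Channel A B) : Prop :=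
  ∀ (r k : ℕ) (x : Prep A B r k), Comparable C (outProb N x) (outProb M x)

theorem UniformlyComparable.symm {C : ℝ} {N M : Channel A B} (h : UniformlyComparable C N M) :
    UniformlyComparable C M N := fun r k x => (h r k x).symm

theorem exists_outProb_le {N M : Channel A B} (h : channelDmax N M < ⊤) :
    ∃ γ : ℝ, ∀ (r k : ℕ) (x : Prep A B r k) (y : Fin k),
      outProb N x y ≤ (2 : ℝ) ^ γ * outProb M x y := by
  obtain ⟨γ, hγ, -⟩ := EReal.lt_iff_exists_real_btwn.1 h
  refine ⟨γ, fun r k x y => ?_⟩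
  have h1 : stateDmax (N.output x.1) (M.output x.1) < γ :=
    lt_of_le_of_lt (le_iSup₂_of_le r x.1 le_rfl) hγ
  simp only [stateDmax, iInf_lt_iff] at h1
  obtain ⟨γ', hpsd, hlt⟩ := h1
  refine (bornProb_le_mul hpsd x.2 y).trans (mul_le_mul_of_nonneg_right ?_ (bornProb_nonneg _ _ _))
  exact Real.rpow_le_rpow_of_exponent_le one_le_two (EReal.coe_lt_coe_iff.1 hlt).le

theorem exists_uniformlyComparable {N M : Channel A B}
    (h : max (channelDmax N M) (channelDmax M N) < ⊤) : ∃ C, UniformlyComparable C N M := by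
  obtain ⟨γ, hγ⟩ := exists_outProb_le ((le_max_left _ _).trans_lt h)
  obtain ⟨γ', hγ'⟩ := exists_outProb_le ((le_max_right _ _).trans_lt h)
  refine ⟨max ((2 : ℝ) ^ γ) ((2 : ℝ) ^ γ'), fun r k x => ⟨outProb_nonneg N x, outProb_nonneg M x,
    sum_bornProb _ _, sum_bornProb _ _, fun y => ?_, fun y => ?_⟩⟩
  · exact (hγ r k x y).trans
      (mul_le_mul_of_nonneg_right (le_max_left _ _) (outProb_nonneg M x y))
  · exact (hγ' r k x y).trans
      (mul_le_mul_of_nonneg_right (le_max_right _ _) (outProb_nonneg N x y))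

/-- By Naimark's theorem the restriction to projective measurements in the measured channel
divergence costs nothing. -/
theorem klDiv_outcomeLaw_le (N M : Channel A B) {r k : ℕ} (x : Prep A B r k) :
    InformationTheory.klDiv (outcomeLaw (N.output x.1) x.2) (outcomeLaw (M.output x.1) x.2)
      ≤ channelMeasuredDiv N M := by
  classical
  obtain ⟨ρ, m⟩ := x
  obtain ⟨r', e, he, m', hproj, hm'⟩ := m.exists_projective_dilation
  let ρ' := ρ.conj (ancEmb A e) (conjTranspose_ancEmb_mul he)
  have h1 : ∀ N : Channel A B, outcomeLaw (N.output ρ') m' = outcomeLaw (N.output ρ) m := by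
    intro N
    refine outcomeLaw_congr ?_
    rw [N.output_conj he ρ]
    exact bornProb_conj _ _ hm'
  change InformationTheory.klDiv (outcomeLaw (N.output ρ) m) (outcomeLaw (M.output ρ) m) ≤ _
  rw [← h1 N, ← h1 M]
  refine le_iSup₂_of_le r' ρ' ?_
  exact le_iSup₂_of_le k m' (le_iSup_of_le hproj le_rfl)

section UniformlyComparable

variable {C : ℝ} {N M : Channel A B}

theorem UniformlyComparable.klDiv_eq (h : UniformlyComparable C N M) {r k : ℕ}
    (x : Prep A B r k) :
    InformationTheory.klDiv (outcomeLaw (N.output x.1) x.2) (outcomeLaw (M.output x.1) x.2)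
      = ENNReal.ofReal (relEnt (outProb N x) (outProb M x)) :=
  klDiv_outcomeLaw (h r k x)

theorem UniformlyComparable.channelMeasuredDiv_ne_top (h : UniformlyComparable C N M) :
    channelMeasuredDiv N M ≠ ⊤ := by
  refine ne_top_of_le_ne_top (ENNReal.ofReal_ne_top (r := Real.log C)) ?_
  refine iSup₂_le fun r ρ => iSup₂_le fun k m => iSup_le fun _ => ?_
  exact (h.klDiv_eq (ρ, m)).trans_le (ENNReal.ofReal_le_ofReal (h r k (ρ, m)).relEnt_le)

theorem UniformlyComparable.relEnt_le (h : UniformlyComparable C N M) {r k : ℕ}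
    (x : Prep A B r k) :
    relEnt (outProb N x) (outProb M x) ≤ (channelMeasuredDiv N M).toReal := by
  have h1 := klDiv_outcomeLaw_le N M x
  rw [h.klDiv_eq x] at h1
  exact (ENNReal.ofReal_le_iff_le_toReal h.channelMeasuredDiv_ne_top).1 h1

theorem UniformlyComparable.exists_lt_relEnt (h : UniformlyComparable C N M) {τ : ℝ} (hτ0 : 0 ≤ τ)
    (hτ : τ < (channelMeasuredDiv N M).toReal) :
    ∃ (r k : ℕ) (x : Prep A B r k), τ < relEnt (outProb N x) (outProb M x) := by
  have h1 := (ENNReal.ofReal_lt_iff_lt_toReal hτ0 h.channelMeasuredDiv_ne_top).2 hτ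
  simp only [channelMeasuredDiv, stateMeasuredDiv, lt_iSup_iff] at h1
  obtain ⟨r, ρ, k, m, -, h2⟩ := h1
  refine ⟨r, k, (ρ, m), ?_⟩
  rw [h.klDiv_eq (ρ, m)] at h2
  exact (ENNReal.ofReal_lt_ofReal_iff_of_nonneg hτ0).1 h2

theorem UniformlyComparable.relEnt_pos (h : UniformlyComparable C N M) {r k : ℕ}
    {x : Prep A B r k} (hx : outProb N x ≠ outProb M x) :
    0 < relEnt (outProb N x) (outProb M x) := by
  rw [← ENNReal.ofReal_pos, ← h.klDiv_eq x, pos_iff_ne_zero]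
  intro h0
  rw [InformationTheory.klDiv_eq_zero_iff] at h0
  apply hx
  funext y
  have h1 := congrArg (fun μ : Measure (Fin k) => μ {y}) h0
  simp only [outcomeLaw_singleton] at h1
  exact (ENNReal.ofReal_eq_ofReal_iff (bornProb_nonneg _ _ _) (bornProb_nonneg _ _ _)).1 h1

/-- A preparation that distinguishes the channels in one direction does so in the other. -/
theorem UniformlyComparable.relEnt_pos_symm (h : UniformlyComparable C N M) {r k : ℕ}
    {x : Prep A B r k} (hx : 0 < relEnt (outProb N x) (outProb M x)) :
    0 < relEnt (outProb M x) (outProb N x) := by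
  apply h.symm.relEnt_pos
  intro heq
  have h0 : relEnt (outProb N x) (outProb M x) = 0 := by
    rw [heq, relEnt]
    refine Finset.sum_eq_zero fun y _ => ?_
    by_cases hy : outProb N x y = 0
    · rw [hy, zero_mul]
    · rw [div_self hy, Real.log_one, mul_zero]
  exact hx.ne' h0

end UniformlyComparable

/-! ### Padding a preparation -/

/-- A measurement on the range of an isometry, extended to the whole space by adding the
complementary projector to the outcome `y₀`. -/
def POVM.extend {Y D D' : Type*} [Fintype Y] [DecidableEq Y] [Fintype D] [DecidableEq D]
    [Fintype D'] [DecidableEq D'] (m : POVM Y D) (V : Matrix D' D ℂ) (hV : Vᴴ * V = 1) (y₀ : Y) :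
    POVM Y D' where
  elem y := V * m.elem y * Vᴴ + if y = y₀ then 1 - V * Vᴴ else 0
  posSemidef y := by
    refine ((m.posSemidef y).mul_mul_conjTranspose_same V).add ?_
    split_ifs
    · have h1 : 1 - V * Vᴴ = (1 - V * Vᴴ)ᴴ * (1 - V * Vᴴ) := by
        rw [conjTranspose_sub, conjTranspose_one, conjTranspose_mul, conjTranspose_conjTranspose,
          Matrix.sub_mul, Matrix.mul_sub, Matrix.mul_sub, Matrix.one_mul, Matrix.mul_one,
          Matrix.one_mul, Matrix.mul_assoc V, ← Matrix.mul_assoc Vᴴ, hV, Matrix.one_mul, sub_self,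
          sub_zero]
      rw [h1]
      exact posSemidef_conjTranspose_mul_self _
    · exact PosSemidef.zero
  sum_eq := by
    rw [Finset.sum_add_distrib, ← Matrix.sum_mul, ← Matrix.mul_sum, m.sum_eq, Matrix.mul_one]
    simp

theorem POVM.compress_extend {Y D D' : Type*} [Fintype Y] [DecidableEq Y] [Fintype D]
    [DecidableEq D] [Fintype D'] [DecidableEq D'] (m : POVM Y D) (V : Matrix D' D ℂ)
    (hV : Vᴴ * V = 1) (y₀ : Y) (y : Y) : Vᴴ * (m.extend V hV y₀).elem y * V = m.elem y := by
  have h1 : Vᴴ * (V * m.elem y * Vᴴ) * V = m.elem y := by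
    calc Vᴴ * (V * m.elem y * Vᴴ) * V = (Vᴴ * V) * m.elem y * (Vᴴ * V) := by
          simp only [Matrix.mul_assoc]
      _ = m.elem y := by rw [hV, Matrix.one_mul, Matrix.mul_one]
  change Vᴴ * (V * m.elem y * Vᴴ + if y = y₀ then 1 - V * Vᴴ else 0) * V = m.elem y
  rw [Matrix.mul_add, Matrix.add_mul, h1]
  split_ifs
  · rw [Matrix.mul_sub, Matrix.mul_one, ← Matrix.mul_assoc, hV, Matrix.one_mul, sub_self,
      Matrix.zero_mul, add_zero]
  · simp

/-- A measurement with `d` further outcomes that never occur. -/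
def POVM.addOutcomes {D : Type*} [Fintype D] [DecidableEq D] {k : ℕ} (m : POVM (Fin k) D) (d : ℕ) :
    POVM (Fin (k + d)) D where
  elem := Fin.append m.elem fun _ => 0
  posSemidef y := by
    refine Fin.addCases (fun i => ?_) (fun i => ?_) y
    · rw [Fin.append_left]
      exact m.posSemidef i
    · rw [Fin.append_right]
      exact PosSemidef.zero
  sum_eq := by
    rw [Fin.sum_univ_add]
    simp [m.sum_eq]

theorem outProb_addOutcomes (N : Channel A B) {r k : ℕ} (x : Prep A B r k) (d : ℕ) :
    outProb N (x.1, x.2.addOutcomes d) = Fin.append (outProb N x) fun _ => 0 := by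
  funext y
  refine Fin.addCases (fun i => ?_) (fun i => ?_) y
  · simp [outProb, bornProb, POVM.addOutcomes]
  · simp [outProb, bornProb, POVM.addOutcomes]

/-- A preparation can be imitated with a larger ancilla and a larger outcome alphabet. -/
theorem exists_padding {r k r' k' : ℕ} (hr : r ≤ r') (hk0 : 0 < k) (hk : k ≤ k')
    (x : Prep A B r k) : ∃ x' : Prep A B r' k', ∀ N M : Channel A B,
      relEnt (outProb N x') (outProb M x') = relEnt (outProb N x) (outProb M x) := by
  classical
  obtain ⟨d, rfl⟩ := Nat.exists_eq_add_of_le hk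
  have he : Function.Injective (Fin.castLE hr) := Fin.castLE_injective hr
  let m₁ := x.2.extend (ancEmb B (Fin.castLE hr)) (conjTranspose_ancEmb_mul he) ⟨0, hk0⟩
  let x₁ : Prep A B r' k :=
    (x.1.conj (ancEmb A (Fin.castLE hr)) (conjTranspose_ancEmb_mul he), m₁)
  have h1 : ∀ N : Channel A B, outProb N x₁ = outProb N x := by
    intro N
    change bornProb (N.output _) _ = bornProb _ _
    rw [N.output_conj he]
    exact bornProb_conj _ _ (x.2.compress_extend _ (conjTranspose_ancEmb_mul he) _)
  refine ⟨(x₁.1, x₁.2.addOutcomes d), fun N M => ?_⟩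
  rw [outProb_addOutcomes, outProb_addOutcomes, relEnt, Fin.sum_univ_add]
  simp [relEnt, h1]

/-! ### Distinct channels have distinct outcome probabilities -/

/-- A Hermitian difference of two states is detected by a measurement in its eigenbasis. -/
theorem State.eq_of_bornProb_eq {D : Type*} [Fintype D] [DecidableEq D] {ρ σ : State D}
    (h : ∀ (k : ℕ) (m : POVM (Fin k) D), bornProb ρ m = bornProb σ m) : ρ = σ := by
  have hX : (ρ.mat - σ.mat).IsHermitian := ρ.posSemidef.isHermitian.sub σ.posSemidef.isHermitian
  set U : Matrix D D ℂ := (hX.eigenvectorUnitary : Matrix D D ℂ) with hU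
  have hU1 : U * Uᴴ = 1 := Unitary.coe_mul_star_self hX.eigenvectorUnitary
  have hW : (Uᴴ)ᴴ * Uᴴ = 1 := by rw [conjTranspose_conjTranspose, hU1]
  have hdiag : Uᴴ * (ρ.mat - σ.mat) * U = diagonal (RCLike.ofReal ∘ hX.eigenvalues) := by
    have := hX.conjStarAlgAut_star_eigenvectorUnitary
    rw [Unitary.conjStarAlgAut_star_apply] at this
    exact this
  have h0 : hX.eigenvalues = 0 := by
    funext i
    have h1 := congrFun (h _ (POVM.ofIsometry Uᴴ hW (Fintype.equivFin D))) (Fintype.equivFin D i)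
    rw [← sub_eq_zero, bornProb, bornProb, ← Complex.sub_re, ← trace_sub, ← Matrix.sub_mul] at h1
    have h2 : ((ρ.mat - σ.mat) * ((Uᴴ)ᴴ * labelProj (Fintype.equivFin D) (Fintype.equivFin D i)
        * Uᴴ)).trace = hX.eigenvalues i := by
      rw [conjTranspose_conjTranspose, ← Matrix.mul_assoc, trace_mul_comm, ← Matrix.mul_assoc,
        ← Matrix.mul_assoc, hdiag, labelProj, diagonal_mul_diagonal, trace_diagonal]
      simp
    change ((ρ.mat - σ.mat) * ((Uᴴ)ᴴ * labelProj (Fintype.equivFin D) (Fintype.equivFin D i)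
        * Uᴴ)).trace.re = 0 at h1
    rw [h2, Complex.ofReal_re] at h1
    exact h1
  exact State.ext_mat (sub_eq_zero.1 (hX.eigenvalues_eq_zero_iff.1 h0))

open scoped MatrixOrder Matrix.Norms.L2Operator in
/-- Two channels with the same outcome probabilities agree on states, and states span. -/
theorem exists_outProb_ne {N M : Channel A B} (hne : N ≠ M) :
    ∃ (r k : ℕ) (x : Prep A B r k), outProb N x ≠ outProb M x := by
  classical
  by_contra! hcon
  apply hne
  have hpsd : ∀ X : Matrix A A ℂ, X.PosSemidef → N.map X = M.map X := by
    intro X hX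
    by_cases ht : X.trace = 0
    · rw [hX.trace_eq_zero_iff.1 ht, map_zero, map_zero]
    let ρ : State (Fin 1 × A) :=
      { mat := (X.trace⁻¹ • X).submatrix Prod.snd Prod.snd
        posSemidef := (hX.smul (inv_nonneg.2 hX.trace_nonneg)).submatrix _
        trace_eq := by
          have h1 : ((X.trace⁻¹ • X).submatrix (Prod.snd : Fin 1 × A → A) Prod.snd).trace
              = (X.trace⁻¹ • X).trace := by
            simp [trace, Fintype.sum_prod_type]
          rw [h1, trace_smul, smul_eq_mul, inv_mul_cancel₀ ht] }
    have h1 : N.output ρ = M.output ρ := State.eq_of_bornProb_eq fun k m => hcon 1 k (ρ, m)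
    have h2 : N.map (X.trace⁻¹ • X) = M.map (X.trace⁻¹ • X) := by
      ext i j
      exact congrFun (congrFun (congrArg State.mat h1) (0, i)) (0, j)
    rw [map_smul, map_smul] at h2
    exact smul_right_injective _ (inv_ne_zero ht) h2
  have hmap : N.map = M.map := by
    refine LinearMap.ext_on (CStarAlgebra.span_nonneg (A := Matrix A A ℂ)) fun X hX => ?_
    exact hpsd X (Matrix.nonneg_iff_posSemidef.1 hX)
  cases N
  cases M
  cases hmap
  rfl

end SingleRound

/-! ### The law of the experiment, one round at a time -/

section Law

variable {A B : Type*} [Fintype A] [Fintype B] [DecidableEq B]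

namespace Strategy

variable (S : Strategy A B)

/-- The records of the rounds `0, …, n`. -/
abbrev Hist (n : ℕ) : Type _ := Finset.Iic n → Round A B S.anc S.out

/-- The records of the rounds `0, …, n` of an infinite record. -/
abbrev past (n : ℕ) (ω : S.Path) : S.Hist n :=
  Preorder.frestrictLe (π := fun _ => Round A B S.anc S.out) n ω

theorem measurable_past (n : ℕ) : Measurable (S.past n) :=
  Preorder.measurable_frestrictLe n

theorem lintegral_law_zero (N : Channel A B) {f : Round A B S.anc S.out → ℝ≥0∞}
    (hf : Measurable f) :
    ∫⁻ ω, f (ω 0) ∂(S.law N)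
      = ∫⁻ x, ∫⁻ y, f (x, y) ∂(outcomeKernel N S.anc S.out x) ∂S.first := by
  have := S.first_prob
  have hmap : (S.law N).map (fun ω => ω 0) = S.firstRound N := by
    have h0 : (S.law N).map (Preorder.frestrictLe (π := fun _ => Round A B S.anc S.out) 0)
        = (S.firstRound N).map (MeasurableEquiv.piUnique
          (fun _ : Finset.Iic 0 => Round A B S.anc S.out)).symm := by
      rw [law, Kernel.trajMeasure, Measure.map_comp _ _ (Preorder.measurable_frestrictLe 0),
        Kernel.traj_map_frestrictLe, Kernel.partialTraj_self, Measure.id_comp]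
    have h1 : (S.law N).map (fun ω => ω 0)
        = ((S.law N).map (S.past 0)).map (fun h : S.Hist 0 => h ⟨0, by simp⟩) := by
      rw [Measure.map_map (measurable_pi_apply _) (S.measurable_past 0)]
      rfl
    rw [h1, h0, Measure.map_map (measurable_pi_apply _) (MeasurableEquiv.measurable _)]
    exact Measure.map_id
  rw [← Measure.lintegral_compProd hf, ← firstRound, ← hmap, lintegral_map hf (by fun_prop)]

theorem lintegral_nextRound (N : Channel A B) (n : ℕ) {f : Round A B S.anc S.out → ℝ≥0∞}
    (hf : Measurable f) (h : S.Hist n) :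
    ∫⁻ r, f r ∂(S.nextRound N n h)
      = ∫⁻ x, ∫⁻ y, f (x, y) ∂(outcomeKernel N S.anc S.out x) ∂(S.next n h) := by
  have := S.next_markov n
  rw [nextRound, Kernel.lintegral_compProd _ _ _ hf]
  rfl

theorem lintegral_law_succ (N : Channel A B) (n : ℕ)
    {f : S.Hist n × Round A B S.anc S.out → ℝ≥0∞} (hf : Measurable f) :
    ∫⁻ ω, f (S.past n ω, ω (n + 1)) ∂(S.law N)
      = ∫⁻ ω, ∫⁻ x, ∫⁻ y, f (S.past n ω, (x, y)) ∂(outcomeKernel N S.anc S.out x)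
          ∂(S.next n (S.past n ω)) ∂(S.law N) := by
  have := S.first_prob
  have := S.next_markov n
  have : IsProbabilityMeasure (S.firstRound N) := by
    unfold firstRound
    infer_instance
  have h1 := Kernel.map_frestrictLe_trajMeasure_compProd_eq_map_trajMeasure
    (X := fun _ => Round A B S.anc S.out) (κ := S.nextRound N) (μ₀ := S.firstRound N) (a := n)
  change (S.law N).map (S.past n) ⊗ₘ S.nextRound N n
    = (S.law N).map (fun ω => (S.past n ω, ω (n + 1))) at h1
  have hm : Measurable fun ω : S.Path => (S.past n ω, ω (n + 1)) :=
    (S.measurable_past n).prodMk (measurable_pi_apply _)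
  rw [← lintegral_map hf hm, ← h1, Measure.lintegral_compProd hf,
    lintegral_map (Measurable.lintegral_kernel_prod_right' hf) (S.measurable_past n)]
  refine lintegral_congr fun ω => ?_
  exact S.lintegral_nextRound N n (hf.comp measurable_prodMk_left) _

end Strategy

end Law

/-! ### A strong converse -/

section Converse

variable {A B : Type*} [Fintype A] [Fintype B] [DecidableEq B]

/-- Jensen's inequality for a power with exponent below one. -/
theorem lintegral_rpow_le {α : Type*} [MeasurableSpace α] (μ : Measure α) [IsProbabilityMeasure μ]
    {f : α → ℝ≥0∞} (hf : Measurable f) {a : ℝ} (h0 : 0 < a) (h1 : a < 1) :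
    ∫⁻ x, f x ^ a ∂μ ≤ (∫⁻ x, f x ∂μ) ^ a := by
  have hconj : (1 / a).HolderConjugate (1 / (1 - a)) := by
    rw [Real.holderConjugate_iff]
    exact ⟨by rw [lt_div_iff₀ h0]; linarith, by simp⟩
  have h := ENNReal.lintegral_mul_le_Lp_mul_Lq μ hconj (hf.pow_const a).aemeasurable
    (aemeasurable_const (b := (1 : ℝ≥0∞)))
  simpa [← ENNReal.rpow_mul, mul_inv_cancel₀ h0.ne'] using h

/-- A randomized choice of the preparation does not spoil a bound on one round. -/
theorem lintegral_round_rpow_le {N M : Channel A B} {r k : ℕ} {a : ℝ} (h0 : 0 < a) (h1 : a < 1)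
    {κ : ℝ≥0∞}
    (hstep : ∀ (x : Prep A B r k) (g : Fin k → ℝ≥0∞),
      ∫⁻ y, g y ^ a ∂(outcomeKernel N r k x) ≤ κ * (∫⁻ y, g y ∂(outcomeKernel M r k x)) ^ a)
    (ν : Measure (Prep A B r k)) [IsProbabilityMeasure ν] {g : Round A B r k → ℝ≥0∞}
    (hg : Measurable g) :
    ∫⁻ x, ∫⁻ y, g (x, y) ^ a ∂(outcomeKernel N r k x) ∂ν
      ≤ κ * (∫⁻ x, ∫⁻ y, g (x, y) ∂(outcomeKernel M r k x) ∂ν) ^ a := by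
  have hm : Measurable fun x => ∫⁻ y, g (x, y) ∂(outcomeKernel M r k x) :=
    Measurable.lintegral_kernel_prod_right' hg
  calc ∫⁻ x, ∫⁻ y, g (x, y) ^ a ∂(outcomeKernel N r k x) ∂ν
      ≤ ∫⁻ x, κ * (∫⁻ y, g (x, y) ∂(outcomeKernel M r k x)) ^ a ∂ν :=
        lintegral_mono fun x => hstep x fun y => g (x, y)
    _ = κ * ∫⁻ x, (∫⁻ y, g (x, y) ∂(outcomeKernel M r k x)) ^ a ∂ν :=
        lintegral_const_mul _ (hm.pow_const a)
    _ ≤ κ * (∫⁻ x, ∫⁻ y, g (x, y) ∂(outcomeKernel M r k x) ∂ν) ^ a :=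
        mul_le_mul_right (lintegral_rpow_le ν hm h0 h1) κ

namespace Strategy

variable (S : Strategy A B)

/-- A history extended by one round. -/
def snoc (n : ℕ) (p : S.Hist n × Round A B S.anc S.out) : S.Hist (n + 1) := fun i =>
  if h : (i : ℕ) ∈ Finset.Iic n then p.1 ⟨i, h⟩ else p.2

theorem measurable_snoc (n : ℕ) : Measurable (S.snoc n) := by
  refine measurable_pi_lambda _ fun i => ?_
  unfold snoc
  split_ifs with h
  · exact (measurable_pi_apply _).comp measurable_fst
  · exact measurable_snd

theorem snoc_past (n : ℕ) (ω : S.Path) : S.snoc n (S.past n ω, ω (n + 1)) = S.past (n + 1) ω := by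
  funext i
  unfold snoc
  split_ifs with h
  · rfl
  · have h1 : (i : ℕ) = n + 1 := by
      have := Finset.mem_Iic.1 i.2
      rw [Finset.mem_Iic] at h
      omega
    change ω (n + 1) = ω i
    rw [h1]

theorem exists_eq_of_first_round {g : S.Hist 0 → ℝ≥0∞} (hg : Measurable g) :
    ∃ f : Round A B S.anc S.out → ℝ≥0∞, Measurable f ∧ ∀ ω, f (ω 0) = g (S.past 0 ω) := by
  refine ⟨fun r => g fun _ => r, hg.comp (measurable_pi_lambda _ fun _ => measurable_id),
    fun ω => ?_⟩
  change g _ = g _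
  congr 1
  funext i
  have : (i : ℕ) = 0 := Nat.le_zero.1 (Finset.mem_Iic.1 i.2)
  change ω 0 = ω i
  rw [this]

/-- The change of measure over `n + 1` rounds, obtained by iterating the bound for one round. -/
theorem lintegral_law_rpow_le {N M : Channel A B} {a : ℝ} (h0 : 0 < a) (h1 : a < 1) {κ : ℝ≥0∞}
    (hstep : ∀ (x : Prep A B S.anc S.out) (g : Fin S.out → ℝ≥0∞),
      ∫⁻ y, g y ^ a ∂(outcomeKernel N S.anc S.out x)
        ≤ κ * (∫⁻ y, g y ∂(outcomeKernel M S.anc S.out x)) ^ a)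
    (n : ℕ) {g : S.Hist n → ℝ≥0∞} (hg : Measurable g) :
    ∫⁻ ω, g (S.past n ω) ^ a ∂(S.law N) ≤ κ ^ (n + 1) * (∫⁻ ω, g (S.past n ω) ∂(S.law M)) ^ a := by
  induction n with
  | zero =>
    have := S.first_prob
    obtain ⟨f, hf, hfg⟩ := S.exists_eq_of_first_round hg
    simp only [← hfg]
    rw [S.lintegral_law_zero N (f := fun r => f r ^ a) (hf.pow_const a),
      S.lintegral_law_zero M hf, zero_add, pow_one]
    exact lintegral_round_rpow_le h0 h1 hstep _ hf
  | succ n ih =>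
    have := S.next_markov n
    have hgs : Measurable fun p => g (S.snoc n p) := hg.comp (S.measurable_snoc n)
    set G : S.Hist n → ℝ≥0∞ := fun h =>
      ∫⁻ x, ∫⁻ y, g (S.snoc n (h, (x, y))) ∂(outcomeKernel M S.anc S.out x) ∂(S.next n h) with hG
    have hGm : Measurable G := by
      have h2 : G = fun h => ∫⁻ r, g (S.snoc n (h, r)) ∂(S.nextRound M n h) := by
        funext h
        exact (S.lintegral_nextRound M n (hgs.comp measurable_prodMk_left) h).symm
      rw [h2]
      exact Measurable.lintegral_kernel_prod_right' hgs
    have hM : ∫⁻ ω, g (S.past (n + 1) ω) ∂(S.law M) = ∫⁻ ω, G (S.past n ω) ∂(S.law M) := by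
      simp only [← S.snoc_past n]
      rw [S.lintegral_law_succ M n (f := fun p => g (S.snoc n p)) hgs]
    calc ∫⁻ ω, g (S.past (n + 1) ω) ^ a ∂(S.law N)
        = ∫⁻ ω, ∫⁻ x, ∫⁻ y, g (S.snoc n (S.past n ω, (x, y))) ^ a
            ∂(outcomeKernel N S.anc S.out x) ∂(S.next n (S.past n ω)) ∂(S.law N) := by
          simp only [← S.snoc_past n]
          rw [S.lintegral_law_succ N n (f := fun p => g (S.snoc n p) ^ a) (hgs.pow_const a)]
      _ ≤ ∫⁻ ω, κ * G (S.past n ω) ^ a ∂(S.law N) := by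
          refine lintegral_mono fun ω => ?_
          exact lintegral_round_rpow_le h0 h1 hstep _ (g := fun r => g (S.snoc n (S.past n ω, r)))
            (hgs.comp measurable_prodMk_left)
      _ = κ * ∫⁻ ω, G (S.past n ω) ^ a ∂(S.law N) :=
          lintegral_const_mul _ ((hGm.comp (S.measurable_past n)).pow_const a)
      _ ≤ κ * (κ ^ (n + 1) * (∫⁻ ω, G (S.past n ω) ∂(S.law M)) ^ a) :=
          mul_le_mul_right (ih hGm) κ
      _ = κ ^ (n + 1 + 1) * (∫⁻ ω, g (S.past (n + 1) ω) ∂(S.law M)) ^ a := by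
          rw [hM, pow_succ' κ (n + 1), mul_assoc]

/-- The records of the rounds `0, …, j`, cut out of the records of the rounds `0, …, n`. -/
abbrev truncate {j n : ℕ} (hj : j ≤ n) (h : S.Hist n) : S.Hist j :=
  Preorder.frestrictLe₂ (π := fun _ => Round A B S.anc S.out) hj h

/-- The event, in terms of the records of the rounds `0, …, n`, that the procedure has stopped by
then and has accepted hypothesis `i`. -/
def stoppedHist (i : Fin 2) (n : ℕ) : Set (S.Hist n) :=
  {h | ∃ j : ℕ, ∃ hj : j ≤ n, S.decide j (S.truncate hj h) = some i ∧
    ∀ l : ℕ, ∀ hl : l < j, S.decide l (S.truncate (hl.le.trans hj) h) = none}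

theorem measurableSet_stoppedHist (i : Fin 2) (n : ℕ) : MeasurableSet (S.stoppedHist i n) := by
  have hd : ∀ (j : ℕ) (hj : j ≤ n) (v : Option (Fin 2)), MeasurableSet
      {h : S.Hist n | S.decide j (S.truncate hj h) = v} := fun j hj v =>
    Preorder.measurable_frestrictLe₂ (X := fun _ => Round A B S.anc S.out) hj
      (S.measurableSet_decide j v)
  simp only [stoppedHist, Set.ofPred_exists, Set.ofPred_and, Set.ofPred_forall]
  exact MeasurableSet.iUnion fun j => MeasurableSet.iUnion fun hj => (hd j hj _).inter
    (MeasurableSet.iInter fun l => MeasurableSet.iInter fun hl => hd l _ _)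

theorem time_eq_of_first {ω : S.Path} {j : ℕ} (hj : S.decideAt j ω ≠ none)
    (hl : ∀ l < j, S.decideAt l ω = none) : S.time ω = ((j + 1 : ℕ) : ℕ∞) := by
  refine le_antisymm (iInf₂_le j hj) (le_iInf₂ fun l hl' => ?_)
  by_contra hlt
  rw [not_le, Nat.cast_lt] at hlt
  exact hl' (hl l (by omega))

theorem past_mem_stoppedHist_subset (i : Fin 2) (n : ℕ) :
    {ω | S.past n ω ∈ S.stoppedHist i n} ⊆ S.accepts i := by
  rintro ω ⟨j, hj, h1, h2⟩
  change S.decideAt j ω = some i at h1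
  refine ⟨j, S.time_eq_of_first (by rw [h1]; simp) fun l hl => h2 l hl, h1⟩

/-- Within `n + 1` rounds the procedure goes on, or errs, or accepts `i`. -/
theorem univ_subset_stopped {i j : Fin 2} (hij : i ≠ j) (n : ℕ) :
    (Set.univ : Set S.Path) ⊆ {ω | ((n + 1 : ℕ) : ℕ∞) < S.time ω} ∪ S.accepts j ∪
      {ω | S.past n ω ∈ S.stoppedHist i n} := by
  intro ω _
  by_cases ht : ((n + 1 : ℕ) : ℕ∞) < S.time ω
  · exact Or.inl (Or.inl ht)
  have hex : ∃ l, S.decideAt l ω ≠ none := by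
    by_contra! hnone
    apply ht
    have : S.time ω = ⊤ := by
      simp [time, hnone]
    rw [this]
    exact ENat.natCast_lt_top _
  classical
  have hs := Nat.find_spec hex
  have hm : ∀ l < Nat.find hex, S.decideAt l ω = none := fun l hl => not_not.1 (Nat.find_min hex hl)
  have htime := S.time_eq_of_first hs hm
  have hle : Nat.find hex ≤ n := by
    rw [htime, not_lt, Nat.cast_le] at ht
    omega
  obtain ⟨v, hv⟩ := Option.ne_none_iff_exists'.1 hs
  by_cases hvi : v = i
  · exact Or.inr ⟨Nat.find hex, hle, by rw [← hvi]; exact hv, fun l hl => hm l hl⟩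
  · have hvj : v = j := by omega
    exact Or.inl (Or.inr ⟨Nat.find hex, htime, by rw [← hvj]; exact hv⟩)

/-- A strong converse for a single strategy: unless the experiment is long or errs under `N`, the
probability of accepting `i` under `M` cannot be small. -/
theorem one_le_excessProb_add {N M : Channel A B} {a : ℝ} (h0 : 0 < a) (h1 : a < 1) {κ : ℝ≥0∞}
    (hstep : ∀ (x : Prep A B S.anc S.out) (g : Fin S.out → ℝ≥0∞),
      ∫⁻ y, g y ^ a ∂(outcomeKernel N S.anc S.out x)
        ≤ κ * (∫⁻ y, g y ∂(outcomeKernel M S.anc S.out x)) ^ a)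
    {i j : Fin 2} (hij : i ≠ j) {m : ℕ} (hm : 0 < m) :
    1 ≤ S.excessProb N m + S.law N (S.accepts j) + κ ^ m * (S.law M (S.accepts i)) ^ a := by
  obtain ⟨n, rfl⟩ := Nat.exists_eq_succ_of_ne_zero hm.ne'
  have hE := S.measurableSet_stoppedHist i n
  have hEm : MeasurableSet {ω | S.past n ω ∈ S.stoppedHist i n} := S.measurable_past n hE
  have key := S.lintegral_law_rpow_le h0 h1 hstep n
    (g := (S.stoppedHist i n).indicator 1) (measurable_one.indicator hE)
  have e1 : ∀ ω, (S.stoppedHist i n).indicator (1 : S.Hist n → ℝ≥0∞) (S.past n ω)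
      = {ω | S.past n ω ∈ S.stoppedHist i n}.indicator 1 ω := fun ω => rfl
  have e2 : ∀ ω, (S.stoppedHist i n).indicator (1 : S.Hist n → ℝ≥0∞) (S.past n ω) ^ a
      = {ω | S.past n ω ∈ S.stoppedHist i n}.indicator 1 ω := by
    intro ω
    by_cases h : S.past n ω ∈ S.stoppedHist i n <;> simp [h, h0]
  simp only [e2] at key
  simp only [e1] at key
  rw [lintegral_indicator_one hEm, lintegral_indicator_one hEm] at key
  calc (1 : ℝ≥0∞) = S.law N Set.univ := measure_univ.symm
    _ ≤ S.law N ({ω | ((n + 1 : ℕ) : ℕ∞) < S.time ω} ∪ S.accepts j ∪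
        {ω | S.past n ω ∈ S.stoppedHist i n}) := measure_mono (S.univ_subset_stopped hij n)
    _ ≤ S.law N {ω | ((n + 1 : ℕ) : ℕ∞) < S.time ω} + S.law N (S.accepts j) +
        S.law N {ω | S.past n ω ∈ S.stoppedHist i n} :=
        (measure_union_le _ _).trans (add_le_add_left (measure_union_le _ _) _)
    _ ≤ _ := by
        refine add_le_add le_rfl (key.trans (mul_le_mul_right ?_ _))
        exact ENNReal.rpow_le_rpow (measure_mono (S.past_mem_stoppedHist_subset i n)) h0.le

end Strategy

end Converse

/-! ### Error exponents -/

section Exponents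

theorem coe_le_log_inv_div_iff {x : ℝ≥0∞} {R : ℝ} {n : ℕ} (hn : 0 < n) :
    (R : EReal) ≤ ENNReal.log x⁻¹ / ((n : ℝ) : EReal)
      ↔ x ≤ ENNReal.ofReal (Real.exp (-(R * n))) := by
  rw [EReal.le_div_iff_mul_le (by exact_mod_cast hn) (EReal.coe_ne_top _), ENNReal.log_inv,
    EReal.le_neg, ← ENNReal.log_le_log_iff, ENNReal.log_ofReal_of_pos (Real.exp_pos _),
    Real.log_exp, EReal.coe_neg, EReal.coe_mul]

theorem log_inv_div_le_coe_iff {x : ℝ≥0∞} {R : ℝ} {n : ℕ} (hn : 0 < n) :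
    ENNReal.log x⁻¹ / ((n : ℝ) : EReal) ≤ R ↔ ENNReal.ofReal (Real.exp (-(R * n))) ≤ x := by
  rw [EReal.div_le_iff_le_mul (by exact_mod_cast hn) (EReal.coe_ne_top _), ENNReal.log_inv,
    EReal.neg_le, ← ENNReal.log_le_log_iff, ENNReal.log_ofReal_of_pos (Real.exp_pos _),
    Real.log_exp, EReal.coe_neg, EReal.coe_mul, mul_comm]

theorem le_errorExponent {e : ℕ → ℝ≥0∞} {R : ℝ}
    (h : ∀ᶠ n : ℕ in atTop, e n ≤ ENNReal.ofReal (Real.exp (-(R * n)))) :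
    (R : EReal) ≤ errorExponent e := by
  refine le_liminf_of_le (by isBoundedDefault) ?_
  filter_upwards [h, eventually_gt_atTop 0] with n hn h0
  exact (coe_le_log_inv_div_iff h0).2 hn

theorem errorExponent_le {e : ℕ → ℝ≥0∞} {R : ℝ}
    (h : ∀ᶠ n : ℕ in atTop, ENNReal.ofReal (Real.exp (-(R * n))) ≤ e n) :
    errorExponent e ≤ (R : EReal) := by
  refine liminf_le_of_frequently_le' (Eventually.frequently ?_)
  filter_upwards [h, eventually_gt_atTop 0] with n hn h0
  exact (log_inv_div_le_coe_iff h0).2 hn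

theorem tendsto_exp_neg_mul {R : ℝ} (hR : 0 < R) :
    Tendsto (fun n : ℕ => Real.exp (-(R * n))) atTop (nhds 0) := by
  refine Real.tendsto_exp_neg_atTop_nhds_zero.comp ?_
  exact tendsto_natCast_atTop_atTop.const_mul_atTop hR

/-- Errors with a positive exponent vanish. -/
theorem tendsto_zero_of_errorExponent {e : ℕ → ℝ≥0∞} {R : ℝ} (hR : 0 < R)
    (h : (R : EReal) ≤ errorExponent e) : Tendsto e atTop (nhds 0) := by
  have h1 : ((R / 2 : ℝ) : EReal) < errorExponent e :=
    lt_of_lt_of_le (EReal.coe_lt_coe_iff.2 (half_lt_self hR)) h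
  have h2 := eventually_lt_of_lt_liminf h1
  have h3 := ENNReal.tendsto_ofReal (tendsto_exp_neg_mul (half_pos hR))
  rw [ENNReal.ofReal_zero] at h3
  refine tendsto_of_tendsto_of_tendsto_of_le_of_le' tendsto_const_nhds h3
    (Eventually.of_forall fun n => zero_le) ?_
  filter_upwards [h2, eventually_gt_atTop 0] with n hn h0
  exact (coe_le_log_inv_div_iff h0).1 hn.le

end Exponents

/-! ### The converse for both constraints -/

section Converse

variable {A B : Type*} [Fintype A] [Fintype B] [DecidableEq B]

theorem Strategy.measurableSet_lt_time (S : Strategy A B) (m : ℕ) :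
    MeasurableSet {ω | (m : ℕ∞) < S.time ω} := by
  have h1 : {ω | (m : ℕ∞) < S.time ω} = {ω | ∀ l < m, S.decideAt l ω = none} := by
    ext ω
    constructor
    · intro h l hl
      by_contra hne
      have h2 : S.time ω ≤ ((l + 1 : ℕ) : ℕ∞) := iInf₂_le l hne
      have h3 := lt_of_lt_of_le h h2
      rw [Nat.cast_lt] at h3
      omega
    · intro h
      refine lt_of_lt_of_le (b := ((m + 1 : ℕ) : ℕ∞)) (by exact_mod_cast m.lt_succ_self) ?_
      refine le_iInf₂ fun l hl => ?_
      by_contra hlt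
      rw [not_le, Nat.cast_lt] at hlt
      exact hl (h l (by omega))
  rw [h1]
  simp only [Set.ofPred_forall]
  exact MeasurableSet.iInter fun l => MeasurableSet.iInter fun _ =>
    S.measurable_past l (S.measurableSet_decide l none)

/-- Markov's inequality for the number of channel uses. -/
theorem Strategy.mul_excessProb_le (S : Strategy A B) (N : Channel A B) (m : ℕ) :
    (m : ℝ≥0∞) * S.excessProb N m ≤ S.expectedTime N := by
  rw [excessProb, ← lintegral_indicator_const (S.measurableSet_lt_time m), expectedTime]
  refine lintegral_mono fun ω => ?_
  by_cases h : (m : ℕ∞) < S.time ω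
  · rw [Set.indicator_of_mem (by exact h)]
    have h1 : ((m : ℕ∞) : ℝ≥0∞) ≤ ((S.time ω : ℕ∞) : ℝ≥0∞) := ENat.toENNReal_le.2 h.le
    simpa using h1
  · rw [Set.indicator_of_notMem (by exact h)]
    exact zero_le

/-- A strong converse: as long as the probability under `N` of more than `m n ≲ (1 + η) n` rounds
stays away from one, the error of accepting `i` under `M` has exponent at most
`(1 + η) D_M(N‖M)`. -/
theorem errorExponent_accepts_le {N M : Channel A B} {C : ℝ} (h : UniformlyComparable C N M)
    {S : ℕ → Strategy A B} {i j : Fin 2} (hij : i ≠ j) {m : ℕ → ℕ} {η δ : ℝ} (hη : 0 ≤ η)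
    (hm0 : ∀ᶠ n in atTop, 0 < m n) (hm : ∀ᶠ n in atTop, (m n : ℝ) ≤ (1 + η) * n + 1)
    (hδ0 : 0 ≤ δ) (hδ : δ < 1)
    (hex : ∀ᶠ n in atTop, (S n).excessProb N (m n) ≤ ENNReal.ofReal δ)
    (hacc : Tendsto (fun n => (S n).law N ((S n).accepts j)) atTop (nhds 0)) :
    errorExponent (fun n => (S n).law M ((S n).accepts i))
      ≤ (((1 + η) * (channelMeasuredDiv N M).toReal : ℝ) : EReal) := by
  set D := (channelMeasuredDiv N M).toReal with hD
  have hD0 : 0 ≤ D := ENNReal.toReal_nonneg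
  rw [← EReal.le_of_forall_lt_iff_le]
  intro R hR
  rw [EReal.coe_lt_coe_iff] at hR
  -- `log C` bounds the log-likelihood ratios; it could be negative only without any preparations
  set c := max (Real.log C) 0 with hc
  have hc0 : 0 ≤ c := le_max_right _ _
  set γ := R - (1 + η) * D with hγ
  have hγ0 : 0 < γ := sub_pos.2 hR
  set s := min 1 γ / (2 * (1 + η) * (1 + c) ^ 2) with hs
  have hmin0 : 0 < min 1 γ := lt_min one_pos hγ0
  have hs0 : 0 < s := by positivity
  have hseq : s * (2 * (1 + η) * (1 + c) ^ 2) = min 1 γ := div_mul_cancel₀ _ (by positivity)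
  have h1s : 0 < 1 + s := by positivity
  set a := s / (1 + s) with ha
  have ha0 : 0 < a := by positivity
  have ha1 : a < 1 := (div_lt_one h1s).2 (by linarith)
  have hle1 : (1 + c) ^ 2 ≤ (1 + η) * (1 + c) ^ 2 :=
    le_mul_of_one_le_left (sq_nonneg _) (by linarith)
  have hsc : s * c ≤ 1 := by
    have h1 : s * (2 * (1 + c) ^ 2) ≤ 1 := by
      calc s * (2 * (1 + c) ^ 2) ≤ s * (2 * (1 + η) * (1 + c) ^ 2) :=
            mul_le_mul_of_nonneg_left (by linarith) hs0.le
        _ ≤ 1 := by rw [hseq]; exact min_le_left _ _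
    nlinarith [mul_nonneg hs0.le hc0, mul_nonneg hs0.le (sq_nonneg c)]
  set E := D + s * c ^ 2 with hE
  have hER : (1 + η) * E < R := by
    have h1 : s * (1 + η) * (2 * (1 + c) ^ 2) ≤ γ := by
      calc s * (1 + η) * (2 * (1 + c) ^ 2) = s * (2 * (1 + η) * (1 + c) ^ 2) := by ring
        _ ≤ γ := by rw [hseq]; exact min_le_right _ _
    have h3 : 0 < s * (1 + η) := by positivity
    have h4 : (1 + η) * (s * c ^ 2) < γ := by
      nlinarith [mul_nonneg h3.le hc0, mul_nonneg h3.le (sq_nonneg c)]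
    rw [hE, mul_add]
    linarith
  have hE0 : 0 ≤ E := by positivity
  have hstep : ∀ (r k : ℕ) (x : Prep A B r k) (g : Fin k → ℝ≥0∞),
      ∫⁻ y, g y ^ a ∂(outcomeKernel N r k x)
        ≤ ENNReal.ofReal (Real.exp (a * E)) * (∫⁻ y, g y ∂(outcomeKernel M r k x)) ^ a := by
    intro r k x g
    have hcomp := h r k x
    have hlog : c = Real.log C := max_eq_left hcomp.log_nonneg
    rw [lintegral_outcomeKernel, lintegral_outcomeKernel, hE, hlog]
    exact hcomp.sum_mul_rpow_le hs0 (hlog ▸ hsc) (h.relEnt_le x) g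
  -- if the error were smaller than `exp (-R n)`, the change of measure would be violated
  have hlim : Tendsto (fun n : ℕ => Real.exp (a * E) * Real.exp (-(a * (R - (1 + η) * E) * n)))
      atTop (nhds 0) := by
    simpa using (tendsto_exp_neg_mul (mul_pos ha0 (sub_pos.2 hER))).const_mul (Real.exp (a * E))
  have hδ2 : 0 < (1 - δ) / 2 := by linarith
  refine errorExponent_le ?_
  filter_upwards [hm0, hm, hex, hlim.eventually (gt_mem_nhds hδ2),
    hacc.eventually (gt_mem_nhds (ENNReal.ofReal_pos.2 hδ2))] with n hn0 hnm hnex hnlim hnacc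
  by_contra hcon
  rw [not_le] at hcon
  have key := (S n).one_le_excessProb_add (N := N) (M := M) ha0 ha1 (hstep _ _) hij hn0
  have hbig : ENNReal.ofReal (Real.exp (a * E)) ^ m n * ((S n).law M ((S n).accepts i)) ^ a
      ≤ ENNReal.ofReal ((1 - δ) / 2) := by
    calc _ ≤ ENNReal.ofReal (Real.exp (a * E)) ^ m n
          * ENNReal.ofReal (Real.exp (-(R * n))) ^ a :=
          mul_le_mul_right (ENNReal.rpow_le_rpow hcon.le ha0.le) _
      _ = ENNReal.ofReal (Real.exp (a * (E * m n - R * n))) := by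
          rw [ENNReal.ofReal_rpow_of_pos (Real.exp_pos _), ← ENNReal.ofReal_pow (Real.exp_pos _).le,
            ← ENNReal.ofReal_mul (by positivity), ← Real.exp_mul, ← Real.exp_nat_mul,
            ← Real.exp_add]
          congr 2
          ring
      _ ≤ ENNReal.ofReal ((1 - δ) / 2) := by
          refine ENNReal.ofReal_le_ofReal (le_trans ?_ hnlim.le)
          rw [← Real.exp_add, Real.exp_le_exp]
          nlinarith [mul_le_mul_of_nonneg_left (mul_le_mul_of_nonneg_left hnm hE0) ha0.le]
  have hfin : (1 : ℝ≥0∞) < 1 := by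
    calc (1 : ℝ≥0∞) ≤ _ := key
      _ < ENNReal.ofReal δ + ENNReal.ofReal ((1 - δ) / 2) + ENNReal.ofReal ((1 - δ) / 2) := by
          refine ENNReal.add_lt_add_of_lt_of_le ?_ ?_ hbig
          · exact ne_top_of_le_ne_top ENNReal.ofReal_ne_top hbig
          · exact ENNReal.add_lt_add_of_le_of_lt
              (ne_top_of_le_ne_top ENNReal.ofReal_ne_top hnex) hnex hnacc
      _ = 1 := by
          rw [add_assoc, ← ENNReal.ofReal_add hδ2.le hδ2.le, ← ENNReal.ofReal_add hδ0 (by linarith)]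
          norm_num
  exact lt_irrefl _ hfin

theorem rate_le_of_excessProb {N M : Channel A B} {C : ℝ} (h : UniformlyComparable C N M)
    {S : ℕ → Strategy A B} {i j : Fin 2} (hij : i ≠ j) {R Q ε : ℝ} (hε1 : ε < 1) (hQ : 0 < Q)
    (hR : (R : EReal) ≤ errorExponent (fun n => (S n).law M ((S n).accepts i)))
    (hQe : (Q : EReal) ≤ errorExponent (fun n => (S n).law N ((S n).accepts j)))
    (hex : limsup (fun n => (S n).excessProb N n) atTop < ENNReal.ofReal ε) :
    R ≤ (channelMeasuredDiv N M).toReal := by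
  have hε0 : 0 ≤ ε := by
    by_contra hneg
    rw [ENNReal.ofReal_of_nonpos (not_le.1 hneg).le] at hex
    exact not_lt_zero hex
  have h1 := errorExponent_accepts_le h hij (m := id) le_rfl (eventually_gt_atTop 0)
    (Eventually.of_forall fun n => by simp) hε0 hε1
    ((eventually_lt_of_limsup_lt hex).mono fun n hn => hn.le)
    (tendsto_zero_of_errorExponent hQ hQe)
  have h2 := hR.trans h1
  rw [EReal.coe_le_coe_iff] at h2
  simpa using h2

/-- Under the expectation constraint Markov's inequality bounds the probability of more than
`(1 + η) n` rounds by about `1 / (1 + η)`, so that the strong converse applies for every `η`. -/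
theorem rate_le_of_expectedTime {N M : Channel A B} {C : ℝ} (h : UniformlyComparable C N M)
    {S : ℕ → Strategy A B} {i j : Fin 2} (hij : i ≠ j) {R Q : ℝ} (hQ : 0 < Q)
    (hR : (R : EReal) ≤ errorExponent (fun n => (S n).law M ((S n).accepts i)))
    (hQe : (Q : EReal) ≤ errorExponent (fun n => (S n).law N ((S n).accepts j)))
    (hex : ∀ᶠ n : ℕ in atTop, (S n).expectedTime N ≤ n + 1) :
    R ≤ (channelMeasuredDiv N M).toReal := by
  have key : ∀ η : ℝ, 0 < η → R ≤ (1 + η) * (channelMeasuredDiv N M).toReal := by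
    intro η hη
    have h1 := errorExponent_accepts_le h hij (S := S) (m := fun n => ⌈(1 + η) * n⌉₊) hη.le
      (δ := (1 + η / 2) / (1 + η))
      ((eventually_gt_atTop 0).mono fun n hn => Nat.ceil_pos.2 (by positivity))
      (Eventually.of_forall fun n => (Nat.ceil_lt_add_one (by positivity)).le)
      (by positivity) ((div_lt_one (by positivity)).2 (by linarith)) ?_
      (tendsto_zero_of_errorExponent hQ hQe)
    · have h2 := hR.trans h1
      rwa [EReal.coe_le_coe_iff] at h2
    filter_upwards [hex, eventually_gt_atTop 0, eventually_ge_atTop ⌈2 / η⌉₊] with n hn hn0 hnη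
    have hn0' : (0 : ℝ) < n := Nat.cast_pos.2 hn0
    have hη2 : 1 ≤ η / 2 * n := by
      have := Nat.ceil_le.1 hnη
      rw [div_le_iff₀ hη] at this
      linarith
    have hmark := ((S n).mul_excessProb_le N ⌈(1 + η) * n⌉₊).trans hn
    have h3 : ENNReal.ofReal ((1 + η) * n) * (S n).excessProb N ⌈(1 + η) * n⌉₊
        ≤ ENNReal.ofReal ((1 + η / 2) * n) := by
      refine le_trans (mul_le_mul_left ?_ _) (hmark.trans ?_)
      · rw [← ENNReal.ofReal_natCast]
        exact ENNReal.ofReal_le_ofReal (Nat.le_ceil _)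
      · have : (n : ℝ≥0∞) + 1 = ENNReal.ofReal (n + 1) := by
          rw [ENNReal.ofReal_add hn0'.le zero_le_one, ENNReal.ofReal_natCast, ENNReal.ofReal_one]
        rw [this]
        exact ENNReal.ofReal_le_ofReal (by linarith)
    have hpos : 0 < (1 + η) * n := by positivity
    have h4 : (1 + η / 2) / (1 + η) = ((1 + η / 2) * n) / ((1 + η) * n) := by
      rw [mul_div_mul_right _ _ hn0'.ne']
    rw [h4, ENNReal.ofReal_div_of_pos hpos, ENNReal.le_div_iff_mul_le
      (Or.inl (ENNReal.ofReal_pos.2 hpos).ne') (Or.inl ENNReal.ofReal_ne_top), mul_comm]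
    exact h3
  set D := (channelMeasuredDiv N M).toReal
  have hlim : Tendsto (fun η : ℝ => (1 + η) * D) (nhdsWithin 0 (Set.Ioi 0)) (nhds ((1 + 0) * D)) :=
    ((continuous_const.add continuous_id).mul continuous_const).continuousWithinAt
  have := ge_of_tendsto hlim (eventually_mem_nhdsWithin.mono fun η hη => key η hη)
  simpa using this

end Converse

/-! ### Runs of rounds with a fixed preparation -/

section Runs

variable {A B : Type*} [Fintype A] [Fintype B] [DecidableEq B]

namespace Strategy

variable (S : Strategy A B)

/-- If the event `F` of the first rounds forces the next `m` preparations to be `x`, the outcomes of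
these rounds behave like independent ones as far as upper bounds are concerned. -/
theorem lintegral_prod_le (N : Channel A B) {a : ℕ} {F : Set (S.Hist a)} (hF : MeasurableSet F)
    {x : Prep A B S.anc S.out} {w : Fin S.out → ℝ≥0∞} {c : ℝ≥0∞}
    (hw : ∫⁻ y, w y ∂(outcomeKernel N S.anc S.out x) ≤ c) (m : ℕ)
    (hnext : ∀ j < m, ∀ ω, S.past a ω ∈ F → S.next (a + j) (S.past (a + j) ω) = Measure.dirac x) :
    ∫⁻ ω, F.indicator 1 (S.past a ω) * ∏ j ∈ Finset.range m, w (ω (a + j + 1)).2 ∂(S.law N)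
      ≤ c ^ m := by
  induction m with
  | zero =>
    calc _ ≤ ∫⁻ _, 1 ∂(S.law N) := lintegral_mono fun ω => by
          rw [Finset.prod_range_zero, mul_one]
          exact Set.indicator_le_self' (fun _ _ => zero_le) _
      _ = c ^ 0 := by simp
  | succ m ih =>
    have hwm : Measurable w := Measurable.of_discrete
    -- the weight of the first `a + m` rounds as a function of their records
    set G : S.Hist (a + m) → ℝ≥0∞ := fun h =>
      F.indicator 1 (S.truncate (Nat.le_add_right a m) h) * ∏ j ∈ Finset.range m,
        if hj : a + j + 1 ∈ Finset.Iic (a + m) then w (h ⟨a + j + 1, hj⟩).2 else 1 with hG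
    have hGm : Measurable G := by
      refine Measurable.mul ((measurable_one.indicator hF).comp
        (Preorder.measurable_frestrictLe₂ (X := fun _ => Round A B S.anc S.out) _)) ?_
      refine Finset.measurable_fun_prod _ fun j _ => ?_
      split_ifs
      · exact hwm.comp (measurable_snd.comp (measurable_pi_apply _))
      · exact measurable_const
    have hGp : ∀ ω, G (S.past (a + m) ω)
        = F.indicator 1 (S.past a ω) * ∏ j ∈ Finset.range m, w (ω (a + j + 1)).2 := by
      intro ω
      refine congrArg₂ (· * ·) rfl (Finset.prod_congr rfl fun j hj => ?_)
      have hj' : a + j + 1 ∈ Finset.Iic (a + m) := by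
        rw [Finset.mem_range] at hj
        rw [Finset.mem_Iic]
        omega
      rw [dif_pos hj']
      rfl
    calc _ = ∫⁻ ω, G (S.past (a + m) ω) * w (ω (a + m + 1)).2 ∂(S.law N) := by
          refine lintegral_congr fun ω => ?_
          rw [hGp, Finset.prod_range_succ, mul_assoc]
      _ = ∫⁻ ω, ∫⁻ x, ∫⁻ y, G (S.past (a + m) ω) * w y ∂(outcomeKernel N S.anc S.out x)
            ∂(S.next (a + m) (S.past (a + m) ω)) ∂(S.law N) :=
          S.lintegral_law_succ N (a + m) (f := fun p => G p.1 * w p.2.2)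
            ((hGm.comp measurable_fst).mul (hwm.comp (measurable_snd.comp measurable_snd)))
      _ ≤ ∫⁻ ω, G (S.past (a + m) ω) * c ∂(S.law N) := by
          refine lintegral_mono fun ω => ?_
          by_cases hω : S.past a ω ∈ F
          · simp only [lintegral_const_mul _ hwm]
            rw [hnext m m.lt_succ_self ω hω, lintegral_dirac' _
              ((Measurable.lintegral_kernel (κ := outcomeKernel N S.anc S.out) hwm).const_mul _)]
            exact mul_le_mul_right hw _
          · have h0 : G (S.past (a + m) ω) = 0 := by
              rw [hGp, Set.indicator_of_notMem hω, zero_mul]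
            simp [h0]
      _ = (∫⁻ ω, F.indicator 1 (S.past a ω) * ∏ j ∈ Finset.range m, w (ω (a + j + 1)).2
            ∂(S.law N)) * c := by
          rw [lintegral_mul_const (f := fun ω => G (S.past (a + m) ω)) _
            (hGm.comp (S.measurable_past _))]
          simp only [hGp]
      _ ≤ c ^ m * c := mul_le_mul_left (ih fun j hj => hnext j (hj.trans m.lt_succ_self)) _
      _ = c ^ (m + 1) := (pow_succ c m).symm

/-- Chernoff's bound for a run of rounds with a fixed preparation. -/
theorem law_run_le (N : Channel A B) {a : ℕ} {F : Set (S.Hist a)} (hF : MeasurableSet F)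
    {x : Prep A B S.anc S.out} {f : Fin S.out → ℝ} {θ : ℝ}
    (hf : ∑ y, outProb N x y * Real.exp (f y) ≤ θ) (m : ℕ)
    (hnext : ∀ j < m, ∀ ω, S.past a ω ∈ F → S.next (a + j) (S.past (a + j) ω) = Measure.dirac x) :
    S.law N {ω | S.past a ω ∈ F ∧ 0 ≤ ∑ j ∈ Finset.range m, f (ω (a + j + 1)).2}
      ≤ ENNReal.ofReal (θ ^ m) := by
  have hθ : 0 ≤ θ := (Finset.sum_nonneg fun y _ =>
    mul_nonneg (outProb_nonneg N x y) (Real.exp_pos _).le).trans hf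
  have hw : ∫⁻ y, ENNReal.ofReal (Real.exp (f y)) ∂(outcomeKernel N S.anc S.out x)
      ≤ ENNReal.ofReal θ := by
    rw [lintegral_outcomeKernel]
    refine le_trans (le_of_eq ?_) (ENNReal.ofReal_le_ofReal hf)
    rw [ENNReal.ofReal_sum_of_nonneg fun y _ =>
      mul_nonneg (outProb_nonneg N x y) (Real.exp_pos _).le]
    exact Finset.sum_congr rfl fun y _ => (ENNReal.ofReal_mul (outProb_nonneg N x y)).symm
  have key := S.lintegral_prod_le N hF hw m hnext
  rw [← ENNReal.ofReal_pow hθ] at key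
  refine le_trans ?_ key
  have hm : Measurable fun ω : S.Path => F.indicator (1 : S.Hist a → ℝ≥0∞) (S.past a ω)
      * ∏ j ∈ Finset.range m, ENNReal.ofReal (Real.exp (f (ω (a + j + 1)).2)) := by
    refine ((measurable_one.indicator hF).comp (S.measurable_past a)).mul ?_
    refine Finset.measurable_fun_prod _ fun j _ => ?_
    exact (Measurable.of_discrete (f := fun y => ENNReal.ofReal (Real.exp (f y)))).comp
      (measurable_snd.comp (measurable_pi_apply _))
  refine le_trans ?_ ((one_mul _).symm.trans_le (mul_meas_ge_le_lintegral hm 1))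
  refine measure_mono fun ω hω => ?_
  change 1 ≤ F.indicator (1 : S.Hist a → ℝ≥0∞) (S.past a ω)
    * ∏ j ∈ Finset.range m, ENNReal.ofReal (Real.exp (f (ω (a + j + 1)).2))
  rw [Set.indicator_of_mem hω.1, Pi.one_apply, one_mul,
    ← ENNReal.ofReal_prod_of_nonneg fun _ _ => (Real.exp_pos _).le, ← Real.exp_sum]
  exact ENNReal.one_le_ofReal.2 (Real.one_le_exp hω.2)

end Strategy

end Runs

/-! ### The three-phase protocol -/

section Protocol

variable {A B : Type*} [Fintype A] [Fintype B] [DecidableEq B]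

/-- The parameters of a three-phase protocol. Round `0` is not used. In the rounds `1, …, n₁` the
sign of the total `guessScore` yields a guess `i`. In the next `n₂` rounds the guess is tested with
the preparation `testPrep i`: if the total `testScore i` is nonnegative, the protocol stops and
accepts `i`. Otherwise the guess is made afresh in a last phase of `n₃` rounds and accepted
without a test. -/
structure Protocol (A B : Type*) [Fintype A] [Fintype B] [DecidableEq B] (r k : ℕ) where
  guessPrep : Prep A B r k
  testPrep : Fin 2 → Prep A B r k
  guessScore : Fin k → ℝ
  testScore : Fin 2 → Fin k → ℝ
  n₁ : ℕ
  n₂ : ℕ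
  n₃ : ℕ

/-- The total score of the rounds `a + 1, …, a + m` in a record of the rounds `0, …, n`. Rounds
that are not on record do not count. -/
noncomputable def score {r k n : ℕ} (f : Fin k → ℝ) (a m : ℕ)
    (h : Finset.Iic n → Round A B r k) : ℝ :=
  ∑ j ∈ Finset.range m, if hj : a + j + 1 ∈ Finset.Iic n then f (h ⟨a + j + 1, hj⟩).2 else 0

theorem measurable_score {r k n : ℕ} (f : Fin k → ℝ) (a m : ℕ) :
    Measurable (score f a m : (Finset.Iic n → Round A B r k) → ℝ) := by
  refine Finset.measurable_fun_sum _ fun j _ => ?_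
  split_ifs
  · exact (Measurable.of_discrete (f := f)).comp (measurable_snd.comp (measurable_pi_apply _))
  · exact measurable_const

theorem score_past (S : Strategy A B) {n a m : ℕ} (h : a + m ≤ n) (f : Fin S.out → ℝ) (ω : S.Path) :
    score f a m (S.past n ω) = ∑ j ∈ Finset.range m, f (ω (a + j + 1)).2 := by
  refine Finset.sum_congr rfl fun j hj => ?_
  have hj' : a + j + 1 ∈ Finset.Iic n := by
    rw [Finset.mem_range] at hj
    rw [Finset.mem_Iic]
    omega
  rw [dif_pos hj']
  rfl

namespace Protocol

variable {r k : ℕ} (P : Protocol A B r k)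

/-- The hypothesis that is favoured by the guess scores of the rounds `a + 1, …, a + m`. -/
noncomputable def guess {n : ℕ} (a m : ℕ) (h : Finset.Iic n → Round A B r k) : Fin 2 :=
  if 0 ≤ score P.guessScore a m h then 0 else 1

theorem measurable_guess {n : ℕ} (a m : ℕ) :
    Measurable (P.guess a m : (Finset.Iic n → Round A B r k) → Fin 2) :=
  Measurable.ite (measurableSet_le measurable_const (measurable_score _ _ _)) measurable_const
    measurable_const

/-- The record of the test phase confirms the guess `i`. -/
def Confirms {n : ℕ} (i : Fin 2) (h : Finset.Iic n → Round A B r k) : Prop :=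
  P.guess 0 P.n₁ h = i ∧ 0 ≤ score (P.testScore i) P.n₁ P.n₂ h

theorem measurableSet_confirms {n : ℕ} (i : Fin 2) :
    MeasurableSet {h : Finset.Iic n → Round A B r k | P.Confirms i h} :=
  (P.measurable_guess _ _ (measurableSet_singleton i)).inter
    (measurableSet_le measurable_const (measurable_score _ _ _))

open scoped Classical in
/-- The decision functions of the protocol. -/
noncomputable def decide (n : ℕ) (h : Finset.Iic n → Round A B r k) : Option (Fin 2) :=
  if n = P.n₁ + P.n₂ then
    if P.Confirms 0 h then some 0 else if P.Confirms 1 h then some 1 else none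
  else if n = P.n₁ + P.n₂ + P.n₃ then some (P.guess (P.n₁ + P.n₂) P.n₃ h) else none

/-- The protocol as an adaptive strategy. -/
noncomputable abbrev strategy : Strategy A B where
  anc := r
  out := k
  first := Measure.dirac P.guessPrep
  first_prob := inferInstance
  next n := if P.n₁ ≤ n ∧ n < P.n₁ + P.n₂ then
      Kernel.deterministic (fun h => P.testPrep (P.guess 0 P.n₁ h))
        ((Measurable.of_discrete (f := P.testPrep)).comp (P.measurable_guess _ _))
    else Kernel.deterministic (fun _ => P.guessPrep) measurable_const
  next_markov n := by
    split_ifs <;> infer_instance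
  decide := P.decide
  measurableSet_decide n v := by
    let _ : MeasurableSpace (Option (Fin 2)) := ⊤
    have hm : Measurable (P.decide n) := by
      unfold decide
      split_ifs
      · exact Measurable.ite (P.measurableSet_confirms 0) measurable_const
          (Measurable.ite (P.measurableSet_confirms 1) measurable_const measurable_const)
      · exact (Measurable.of_discrete (f := fun i : Fin 2 => some i)).comp (P.measurable_guess _ _)
      · exact measurable_const
    exact hm (show MeasurableSet {v} from trivial)

theorem next_of_guessing {n : ℕ} (hn : ¬ (P.n₁ ≤ n ∧ n < P.n₁ + P.n₂))
    (h : P.strategy.Hist n) : P.strategy.next n h = Measure.dirac P.guessPrep := by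
  change (if P.n₁ ≤ n ∧ n < P.n₁ + P.n₂ then
      Kernel.deterministic (fun h => P.testPrep (P.guess 0 P.n₁ h)) _
    else Kernel.deterministic (fun _ => P.guessPrep) _ : Kernel _ _) h = _
  rw [if_neg hn]
  exact Kernel.deterministic_apply _ _

theorem next_of_testing {n : ℕ} (hn : P.n₁ ≤ n ∧ n < P.n₁ + P.n₂)
    (h : P.strategy.Hist n) :
    P.strategy.next n h = Measure.dirac (P.testPrep (P.guess 0 P.n₁ h)) := by
  change (if P.n₁ ≤ n ∧ n < P.n₁ + P.n₂ then
      Kernel.deterministic (fun h => P.testPrep (P.guess 0 P.n₁ h)) _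
    else Kernel.deterministic (fun _ => P.guessPrep) _ : Kernel _ _) h = _
  rw [if_pos hn]
  exact Kernel.deterministic_apply _ _

/-- The guess depends on the first phase only. -/
theorem guess_past {n a m : ℕ} (h : a + m ≤ n) (ω : P.strategy.Path) :
    P.guess a m (P.strategy.past n ω) = P.guess a m (P.strategy.past (a + m) ω) := by
  unfold guess
  rw [score_past P.strategy h, score_past P.strategy le_rfl]

theorem decideAt_test (ω : P.strategy.Path)
    [Decidable (P.Confirms 0 (P.strategy.past (P.n₁ + P.n₂) ω))]
    [Decidable (P.Confirms 1 (P.strategy.past (P.n₁ + P.n₂) ω))] :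
    P.strategy.decideAt (P.n₁ + P.n₂) ω =
      if P.Confirms 0 (P.strategy.past (P.n₁ + P.n₂) ω) then some 0
      else if P.Confirms 1 (P.strategy.past (P.n₁ + P.n₂) ω) then some 1 else none := by
  change P.decide (P.n₁ + P.n₂) (P.strategy.past (P.n₁ + P.n₂) ω) = _
  unfold decide
  rw [if_pos rfl]
  congr

theorem decideAt_final (h : 0 < P.n₃) (ω : P.strategy.Path) :
    P.strategy.decideAt (P.n₁ + P.n₂ + P.n₃) ω
      = some (P.guess (P.n₁ + P.n₂) P.n₃ (P.strategy.past (P.n₁ + P.n₂ + P.n₃) ω)) := by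
  change P.decide (P.n₁ + P.n₂ + P.n₃) (P.strategy.past (P.n₁ + P.n₂ + P.n₃) ω) = _
  unfold decide
  rw [if_neg (by omega), if_pos rfl]

theorem accepts_subset (i : Fin 2) : P.strategy.accepts i ⊆
    {ω | P.Confirms i (P.strategy.past (P.n₁ + P.n₂) ω)} ∪
    {ω | P.guess (P.n₁ + P.n₂) P.n₃ (P.strategy.past (P.n₁ + P.n₂ + P.n₃) ω) = i} := by
  classical
  rintro ω ⟨n, -, hn⟩
  by_cases h1 : n = P.n₁ + P.n₂
  · subst h1
    rw [decideAt_test] at hn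
    split_ifs at hn with h0 h1
    · exact Or.inl (Option.some.inj hn ▸ h0)
    · exact Or.inl (Option.some.inj hn ▸ h1)
  · by_cases h2 : n = P.n₁ + P.n₂ + P.n₃
    · subst h2
      rw [decideAt_final _ (by omega)] at hn
      exact Or.inr (Option.some.inj hn)
    · change P.decide n _ = _ at hn
      unfold decide at hn
      rw [if_neg h1, if_neg h2] at hn
      exact absurd hn (by simp)

theorem time_le (h : 0 < P.n₃) (ω : P.strategy.Path) :
    P.strategy.time ω ≤ ((P.n₁ + P.n₂ + P.n₃ + 1 : ℕ) : ℕ∞) :=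
  iInf₂_le _ (by rw [decideAt_final _ h]; simp)

theorem time_le_of_confirms {i : Fin 2} {ω : P.strategy.Path}
    (h : P.Confirms i (P.strategy.past (P.n₁ + P.n₂) ω)) :
    P.strategy.time ω ≤ ((P.n₁ + P.n₂ + 1 : ℕ) : ℕ∞) := by
  classical
  refine iInf₂_le _ ?_
  rw [decideAt_test]
  split_ifs with h0 h1
  · simp
  · simp
  · exfalso
    fin_cases i
    · exact h0 h
    · exact h1 h

/-- The probability of a guess other than `i` from `m` rounds with the guessing preparation. The
sign turns the score against `i` into a nonnegative quantity. -/
theorem law_guess_le (N : Channel A B) {a m : ℕ} {i : Fin 2}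
    (hphase : ∀ j < m, ¬ (P.n₁ ≤ a + j ∧ a + j < P.n₁ + P.n₂)) {s θ : ℝ} (hs : 0 < s)
    (hθ : ∑ y, outProb N P.guessPrep y
      * Real.exp (s * ((if i = 0 then -1 else 1) * P.guessScore y)) ≤ θ) :
    P.strategy.law N {ω | P.guess a m (P.strategy.past (a + m) ω) ≠ i}
      ≤ ENNReal.ofReal (θ ^ m) := by
  refine le_trans (measure_mono ?_) (P.strategy.law_run_le N (a := a) (F := Set.univ)
    MeasurableSet.univ hθ m fun j hj ω _ => P.next_of_guessing (hphase j hj) _)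
  intro ω hω
  refine ⟨trivial, ?_⟩
  change P.guess a m (P.strategy.past (a + m) ω) ≠ i at hω
  unfold guess at hω
  rw [score_past P.strategy le_rfl] at hω
  rw [← Finset.mul_sum, ← Finset.mul_sum]
  refine mul_nonneg hs.le ?_
  by_cases hi : i = 0
  · have h1 : ¬ 0 ≤ ∑ j ∈ Finset.range m, P.guessScore (ω (a + j + 1)).2 := fun h =>
      hω (by rw [if_pos h, hi])
    rw [if_pos hi, neg_one_mul, neg_nonneg]
    exact (not_le.1 h1).le
  · rw [if_neg hi, one_mul]
    by_contra h1
    refine hω ?_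
    rw [if_neg h1]
    omega

/-- Chernoff's bound for the test phase, on the event that the guess is `i`. The score `f` need not
be the one that the protocol uses. -/
theorem law_test_le (N : Channel A B) {i : Fin 2} {f : Fin k → ℝ} {θ : ℝ}
    (hθ : ∑ y, outProb N (P.testPrep i) y * Real.exp (f y) ≤ θ) :
    P.strategy.law N {ω | P.guess 0 P.n₁ (P.strategy.past (P.n₁ + P.n₂) ω) = i ∧
        0 ≤ score f P.n₁ P.n₂ (P.strategy.past (P.n₁ + P.n₂) ω)} ≤ ENNReal.ofReal (θ ^ P.n₂) := by
  have hG : ∀ n, P.n₁ ≤ n → ∀ ω, P.guess 0 P.n₁ (P.strategy.past n ω)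
      = P.guess 0 P.n₁ (P.strategy.past P.n₁ ω) := by
    intro n hn ω
    rw [P.guess_past (by omega), P.guess_past (n := P.n₁) (by omega)]
  refine le_trans (measure_mono ?_) (P.strategy.law_run_le N (a := P.n₁)
    (F := {h : P.strategy.Hist P.n₁ | P.guess 0 P.n₁ h = i})
    (P.measurable_guess _ _ (measurableSet_singleton i)) hθ P.n₂ fun j hj ω hω => ?_)
  · rintro ω ⟨h1, h2⟩
    refine ⟨(hG _ (Nat.le_add_right _ _) ω).symm.trans h1, ?_⟩
    rw [score_past P.strategy le_rfl] at h2
    exact h2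
  · rw [P.next_of_testing ⟨by omega, by omega⟩, hG _ (Nat.le_add_right _ _)]
    exact congrArg (fun i => Measure.dirac (P.testPrep i)) hω

end Protocol

end Protocol

/-! ### Analysis of the protocol -/

section Achievability

variable {A B : Type*} [Fintype A] [Fintype B] [DecidableEq B]

theorem score_const_mul {r k n : ℕ} (c : ℝ) (f : Fin k → ℝ) (a m : ℕ)
    (h : Finset.Iic n → Round A B r k) :
    score (fun y => c * f y) a m h = c * score f a m h := by
  unfold score
  rw [Finset.mul_sum]
  refine Finset.sum_congr rfl fun j _ => ?_
  split_ifs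
  · rfl
  · rw [mul_zero]

theorem pos_of_relEnt_pos {N M : Channel A B} {r k : ℕ} {x : Prep A B r k}
    (h : 0 < relEnt (outProb N x) (outProb M x)) : 0 < k := by
  rcases Nat.eq_zero_or_pos k with rfl | hk
  · simp [relEnt] at h
  · exact hk

/-- Nearly optimal preparations for testing either hypothesis, on a common ancilla and with a common
outcome alphabet. -/
theorem exists_testPrep {N : Fin 2 → Channel A B} {C : ℝ}
    (h : ∀ i j, i ≠ j → UniformlyComparable C (N i) (N j)) {τ : Fin 2 → ℝ} (hτ0 : ∀ i, 0 ≤ τ i)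
    (hτ : ∀ i j, i ≠ j → τ i < (channelMeasuredDiv (N i) (N j)).toReal) :
    ∃ (r k : ℕ) (x : Fin 2 → Prep A B r k), ∀ i j, i ≠ j →
      τ i < relEnt (outProb (N i) (x i)) (outProb (N j) (x i)) := by
  obtain ⟨r₀, k₀, y₀, hy₀⟩ := (h 0 1 (by decide)).exists_lt_relEnt (hτ0 0) (hτ 0 1 (by decide))
  obtain ⟨r₁, k₁, y₁, hy₁⟩ := (h 1 0 (by decide)).exists_lt_relEnt (hτ0 1) (hτ 1 0 (by decide))
  obtain ⟨x₀, hx₀⟩ := exists_padding (le_max_left r₀ r₁)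
    (pos_of_relEnt_pos ((hτ0 0).trans_lt hy₀)) (le_max_left k₀ k₁) y₀
  obtain ⟨x₁, hx₁⟩ := exists_padding (le_max_right r₀ r₁)
    (pos_of_relEnt_pos ((hτ0 1).trans_lt hy₁)) (le_max_right k₀ k₁) y₁
  refine ⟨max r₀ r₁, max k₀ k₁, ![x₀, x₁], fun i j hij => ?_⟩
  fin_cases i <;> fin_cases j
  · exact absurd rfl hij
  · exact hy₀.trans_eq (hx₀ (N 0) (N 1)).symm
  · exact hy₁.trans_eq (hx₁ (N 1) (N 0)).symm
  · exact absurd rfl hij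

/-- The three-phase protocol with log-likelihood ratios as scores: the error of the test is
controlled by the threshold `τ`, everything else that can go wrong has exponentially small
probability in the length of the phase concerned. -/
theorem exists_strategy {N : Fin 2 → Channel A B} {C : ℝ}
    (h : ∀ i j, i ≠ j → UniformlyComparable C (N i) (N j)) {τ : Fin 2 → ℝ} (hτ0 : ∀ i, 0 ≤ τ i)
    (hτ : ∀ i j, i ≠ j → τ i < (channelMeasuredDiv (N i) (N j)).toReal) :
    ∃ θ ∈ Set.Ioo (0 : ℝ) 1, ∀ n₁ n₂ n₃ : ℕ, 0 < n₃ → ∃ S : Strategy A B, ∀ i j, i ≠ j →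
      S.law (N i) (S.accepts j) ≤ ENNReal.ofReal (Real.exp (-τ j) ^ n₂ + θ ^ n₃) ∧
      (∀ n, n₁ + n₂ + 1 ≤ n → S.excessProb (N i) n ≤ ENNReal.ofReal (θ ^ n₁ + θ ^ n₂)) ∧
      S.expectedTime (N i) ≤ ((n₁ + n₂ + 1 : ℕ) : ℝ≥0∞) +
        ((n₁ + n₂ + n₃ + 1 : ℕ) : ℝ≥0∞) * ENNReal.ofReal (θ ^ n₁ + θ ^ n₂) := by
  obtain ⟨r, k, x, hx⟩ := exists_testPrep h hτ0 hτ
  have hne : ∀ i : Fin 2, i ≠ 1 - i := by decide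
  have hsub : ∀ i j : Fin 2, i ≠ j → 1 - i = j := by decide
  -- the preparation for testing hypothesis `0` also serves for guessing
  have hg0 : 0 < relEnt (outProb (N 0) (x 0)) (outProb (N 1) (x 0)) :=
    (hτ0 0).trans_lt (hx 0 1 (by decide))
  have hg : ∀ i : Fin 2, 0 < relEnt (outProb (N i) (x 0)) (outProb (N (1 - i)) (x 0)) := by
    intro i
    fin_cases i
    · exact hg0
    · exact (h 0 1 (by decide)).relEnt_pos_symm hg0
  choose sg hsg θg hθg hgc using fun i => (h i (1 - i) (hne i) r k (x 0)).exists_chernoff (hg i)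
  choose st hst θt hθt htc using fun i =>
    (h i (1 - i) (hne i) r k (x i)).exists_chernoff (hx i (1 - i) (hne i))
  set θ := max (max (θg 0) (θg 1)) (max (θt 0) (θt 1)) with hθ
  have hgθ : ∀ i, θg i ≤ θ := by
    intro i
    fin_cases i
    · exact (le_max_left _ _).trans (le_max_left _ _)
    · exact (le_max_right _ _).trans (le_max_left _ _)
  have htθ : ∀ i, θt i ≤ θ := by
    intro i
    fin_cases i
    · exact (le_max_left _ _).trans (le_max_right _ _)
    · exact (le_max_right _ _).trans (le_max_right _ _)
  have hθ0 : 0 < θ := (hθg 0).1.trans_le (hgθ 0)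
  refine ⟨θ, ⟨hθ0, max_lt (max_lt (hθg 0).2 (hθg 1).2) (max_lt (hθt 0).2 (hθt 1).2)⟩,
    fun n₁ n₂ n₃ hn₃ => ?_⟩
  let P : Protocol A B r k :=
    { guessPrep := x 0
      testPrep := x
      guessScore := fun y => Real.log (outProb (N 0) (x 0) y / outProb (N 1) (x 0) y)
      testScore := fun i y =>
        Real.log (outProb (N i) (x i) y / outProb (N (1 - i)) (x i) y) - τ i
      n₁ := n₁
      n₂ := n₂
      n₃ := n₃ }
  refine ⟨P.strategy, fun i j hij => ?_⟩
  have hguess : ∀ a m, (∀ l < m, ¬ (n₁ ≤ a + l ∧ a + l < n₁ + n₂)) →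
      P.strategy.law (N i) {ω | P.guess a m (P.strategy.past (a + m) ω) ≠ i}
        ≤ ENNReal.ofReal (θ ^ m) := by
    intro a m hphase
    refine (P.law_guess_le (N i) hphase (hsg i) (θ := θg i) ?_).trans
      (ENNReal.ofReal_le_ofReal (pow_le_pow_left₀ (hθg i).1.le (hgθ i) m))
    refine le_trans (le_of_eq (Finset.sum_congr rfl fun y _ => ?_)) (hgc i)
    congr 3
    rw [zero_sub]
    fin_cases i
    · exact neg_one_mul _
    · change 1 * Real.log (outProb (N 0) (x 0) y / outProb (N 1) (x 0) y)
        = -Real.log (outProb (N 1) (x 0) y / outProb (N 0) (x 0) y)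
      rw [one_mul, ← Real.log_inv, inv_div]
  have hfail : P.strategy.law (N i) {ω | ¬ P.Confirms i (P.strategy.past (n₁ + n₂) ω)}
      ≤ ENNReal.ofReal (θ ^ n₁ + θ ^ n₂) := by
    have h1 := hguess 0 n₁ fun l hl hcon => by omega
    have h2 := P.law_test_le (N i) (i := i) (htc i)
    calc P.strategy.law (N i) {ω | ¬ P.Confirms i (P.strategy.past (n₁ + n₂) ω)}
        ≤ _ := measure_mono ?_
      _ ≤ _ := measure_union_le _ _
      _ ≤ ENNReal.ofReal (θ ^ n₁) + ENNReal.ofReal (θ ^ n₂) :=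
          add_le_add h1 (h2.trans
            (ENNReal.ofReal_le_ofReal (pow_le_pow_left₀ (hθt i).1.le (htθ i) n₂)))
      _ = ENNReal.ofReal (θ ^ n₁ + θ ^ n₂) :=
          (ENNReal.ofReal_add (pow_nonneg hθ0.le _) (pow_nonneg hθ0.le _)).symm
    intro ω hω
    by_cases hgi : P.guess 0 n₁ (P.strategy.past (n₁ + n₂) ω) = i
    · refine Or.inr ⟨hgi, ?_⟩
      have h3 : ¬ 0 ≤ score (P.testScore i) n₁ n₂ (P.strategy.past (n₁ + n₂) ω) := fun h0 =>
        hω ⟨hgi, h0⟩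
      have h4 : (fun y => st i * (τ i - Real.log (outProb (N i) (x i) y
          / outProb (N (1 - i)) (x i) y))) = fun y => -st i * P.testScore i y := by
        funext y
        change _ = -st i * (Real.log (outProb (N i) (x i) y / outProb (N (1 - i)) (x i) y) - τ i)
        ring
      change 0 ≤ score (fun y => st i * (τ i - Real.log (outProb (N i) (x i) y
          / outProb (N (1 - i)) (x i) y))) n₁ n₂ (P.strategy.past (n₁ + n₂) ω)
      rw [h4, score_const_mul, neg_mul, ← mul_neg]
      exact mul_nonneg (hst i).le (neg_nonneg.2 (not_le.1 h3).le)
    · refine Or.inl ?_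
      rw [P.guess_past (by omega)] at hgi
      exact hgi
  have hconf : P.strategy.law (N i) {ω | P.Confirms j (P.strategy.past (n₁ + n₂) ω)}
      ≤ ENNReal.ofReal (Real.exp (-τ j) ^ n₂) := by
    refine P.law_test_le (N i) (i := j) (f := P.testScore j) ?_
    have h1 := (h j i hij.symm r k (x j)).sum_mul_exp_log
    have h2 : 1 - j = i := hsub j i hij.symm
    refine le_of_eq ?_
    calc ∑ y, outProb (N i) (x j) y * Real.exp (Real.log (outProb (N j) (x j) y
          / outProb (N (1 - j)) (x j) y) - τ j)
        = (∑ y, outProb (N i) (x j) y * Real.exp (Real.log (outProb (N j) (x j) y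
          / outProb (N i) (x j) y))) * Real.exp (-τ j) := by
          rw [h2, Finset.sum_mul]
          refine Finset.sum_congr rfl fun y _ => ?_
          rw [sub_eq_add_neg, Real.exp_add, mul_assoc]
      _ = Real.exp (-τ j) := by rw [h1, one_mul]
  have hexc : ∀ n, n₁ + n₂ + 1 ≤ n →
      P.strategy.excessProb (N i) n ≤ ENNReal.ofReal (θ ^ n₁ + θ ^ n₂) := by
    intro n hn
    refine le_trans (measure_mono ?_) hfail
    intro ω hω hc
    have h1 := lt_of_lt_of_le hω (P.time_le_of_confirms hc)
    rw [Nat.cast_lt] at h1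
    exact absurd h1 (not_lt.2 hn)
  refine ⟨?_, hexc, ?_⟩
  · calc P.strategy.law (N i) (P.strategy.accepts j)
        ≤ _ := measure_mono (P.accepts_subset j)
      _ ≤ _ := measure_union_le _ _
      _ ≤ ENNReal.ofReal (Real.exp (-τ j) ^ n₂) + ENNReal.ofReal (θ ^ n₃) := by
          refine add_le_add hconf (le_trans (measure_mono fun ω hω => ?_)
            (hguess (n₁ + n₂) n₃ fun l hl hcon => by omega))
          exact fun hi => hij (hi.symm.trans hω)
      _ = ENNReal.ofReal (Real.exp (-τ j) ^ n₂ + θ ^ n₃) :=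
          (ENNReal.ofReal_add (pow_nonneg (Real.exp_pos _).le _) (pow_nonneg hθ0.le _)).symm
  · have hmeas := P.strategy.measurableSet_lt_time (n₁ + n₂ + 1)
    calc P.strategy.expectedTime (N i)
        ≤ ∫⁻ ω, ((n₁ + n₂ + 1 : ℕ) : ℝ≥0∞) +
            {ω | ((n₁ + n₂ + 1 : ℕ) : ℕ∞) < P.strategy.time ω}.indicator
              (fun _ => ((n₁ + n₂ + n₃ + 1 : ℕ) : ℝ≥0∞)) ω ∂(P.strategy.law (N i)) := by
          refine lintegral_mono fun ω => ?_
          by_cases hω : ((n₁ + n₂ + 1 : ℕ) : ℕ∞) < P.strategy.time ω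
          · rw [Set.indicator_of_mem (by exact hω)]
            refine le_add_left ?_
            exact (ENat.toENNReal_le.2 (P.time_le hn₃ ω)).trans_eq (ENat.toENNReal_coe _)
          · rw [Set.indicator_of_notMem (by exact hω), add_zero]
            exact (ENat.toENNReal_le.2 (not_lt.1 hω)).trans_eq (ENat.toENNReal_coe _)
      _ = ((n₁ + n₂ + 1 : ℕ) : ℝ≥0∞) + ((n₁ + n₂ + n₃ + 1 : ℕ) : ℝ≥0∞) *
            P.strategy.excessProb (N i) (n₁ + n₂ + 1) := by
          rw [lintegral_add_left measurable_const, lintegral_const, measure_univ, mul_one,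
            lintegral_indicator_const hmeas, Strategy.excessProb]
      _ ≤ _ := add_le_add le_rfl (mul_le_mul_right (hexc _ le_rfl) _)

end Achievability

/-! ### The error exponent regions -/

section Regions

variable {A B : Type*} [Fintype A] [Fintype B] [DecidableEq B]

/-- All pairs of rates below the measured divergences are attained, with an expected number of
rounds at most `n` and with more than `n` rounds in vanishing probability. -/
theorem exists_strategies {N : Fin 2 → Channel A B} {C : ℝ}
    (h : ∀ i j, i ≠ j → UniformlyComparable C (N i) (N j)) {ρ : Fin 2 → ℝ} (hρ0 : ∀ i, 0 < ρ i)
    (hρ : ∀ i j, i ≠ j → ρ i < (channelMeasuredDiv (N i) (N j)).toReal) :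
    ∃ S : ℕ → Strategy A B, ∀ i j, i ≠ j →
      (ρ j : EReal) ≤ errorExponent (fun n => (S n).law (N i) ((S n).accepts j)) ∧
      Tendsto (fun n => (S n).excessProb (N i) n) atTop (nhds 0) ∧
      ∀ᶠ n : ℕ in atTop, (S n).expectedTime (N i) ≤ n := by
  have hne : ∀ i : Fin 2, i ≠ 1 - i := by decide
  have hsub : ∀ i j : Fin 2, i ≠ j → 1 - i = j := by decide
  set τ : Fin 2 → ℝ := fun i => (ρ i + (channelMeasuredDiv (N i) (N (1 - i))).toReal) / 2 with hτ
  have hρτ : ∀ i, ρ i < τ i := fun i => left_lt_add_div_two.2 (hρ i _ (hne i))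
  have hτ0 : ∀ i, 0 < τ i := fun i => (hρ0 i).trans (hρτ i)
  have hτD : ∀ i j, i ≠ j → τ i < (channelMeasuredDiv (N i) (N j)).toReal := by
    intro i j hij
    have h1 := add_div_two_lt_right.2 (hρ i _ (hne i))
    rwa [← hsub i j hij]
  obtain ⟨θ, ⟨hθ0, hθ1⟩, hθ⟩ := exists_strategy h (fun i => (hτ0 i).le) hτD
  -- the fraction `η` of the rounds for guessing is small enough that `(1 - 2 η) τ i > ρ i`
  set η := min ((τ 0 - ρ 0) / (4 * τ 0)) ((τ 1 - ρ 1) / (4 * τ 1)) with hη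
  have hη0 : 0 < η := lt_min
    (div_pos (sub_pos.2 (hρτ 0)) (mul_pos four_pos (hτ0 0)))
    (div_pos (sub_pos.2 (hρτ 1)) (mul_pos four_pos (hτ0 1)))
  have hητ : ∀ i, 4 * (η * τ i) ≤ τ i - ρ i := by
    intro i
    have h1 : η ≤ (τ i - ρ i) / (4 * τ i) := by
      fin_cases i
      · exact min_le_left _ _
      · exact min_le_right _ _
    rw [le_div_iff₀ (mul_pos four_pos (hτ0 i))] at h1
    linarith
  have hη4 : η ≤ 1 / 4 := by
    have h1 := hητ 0
    by_contra hcon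
    nlinarith [mul_pos (sub_pos.2 (not_le.1 hcon)) (hτ0 0), hρ0 0]
  set μ := ρ 0 + ρ 1 + 1 with hμ
  have hρμ : ∀ i, ρ i + 1 ≤ μ := by
    intro i
    have h0 := hρ0 0
    have h1 := hρ0 1
    fin_cases i
    · change ρ 0 + 1 ≤ μ
      linarith
    · change ρ 1 + 1 ≤ μ
      linarith
  obtain ⟨K, hK⟩ := exists_pow_lt_of_lt_one (Real.exp_pos (-μ)) hθ1
  choose S hS using fun n : ℕ =>
    hθ ⌊η * n⌋₊ ⌊(1 - 2 * η) * n⌋₊ (K * n + 1) (Nat.succ_pos _)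
  have hη2 : 0 < 1 - 2 * η := by linarith
  have hpow : ∀ c : ℝ, 0 < c → Tendsto (fun n : ℕ => θ ^ ⌊c * n⌋₊) atTop (nhds 0) := fun c hc =>
    (tendsto_pow_atTop_nhds_zero_of_lt_one hθ0.le hθ1).comp
      (tendsto_nat_floor_atTop.comp (tendsto_natCast_atTop_atTop.const_mul_atTop hc))
  have hq : Tendsto (fun n : ℕ => θ ^ ⌊η * n⌋₊ + θ ^ ⌊(1 - 2 * η) * n⌋₊) atTop (nhds 0) := by
    simpa using (hpow η hη0).add (hpow _ hη2)
  have hfl : ∀ n : ℕ, ((⌊η * n⌋₊ : ℕ) : ℝ) + ((⌊(1 - 2 * η) * n⌋₊ : ℕ) : ℝ) ≤ (1 - η) * n := by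
    intro n
    have h1 := Nat.floor_le (mul_nonneg hη0.le (Nat.cast_nonneg (α := ℝ) n))
    have h2 := Nat.floor_le (mul_nonneg hη2.le (Nat.cast_nonneg (α := ℝ) n))
    linarith
  have hlarge : ∀ᶠ n : ℕ in atTop, 2 ≤ η * (n : ℝ) :=
    (tendsto_natCast_atTop_atTop.const_mul_atTop hη0).eventually_ge_atTop 2
  refine ⟨S, fun i j hij => ⟨le_errorExponent ?_, ?_, ?_⟩⟩
  · set γ := τ j * (1 - 2 * η) - ρ j with hγ
    have hγ0 : 0 < γ := by
      have h1 := hητ j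
      have h2 := mul_pos hη0 (hτ0 j)
      rw [hγ]
      nlinarith
    have hlim : Tendsto (fun n : ℕ => Real.exp (τ j) * Real.exp (-(γ * n))
        + Real.exp (-(1 * (n : ℝ)))) atTop (nhds 0) := by
      simpa only [mul_zero, add_zero] using
        ((tendsto_exp_neg_mul hγ0).const_mul (Real.exp (τ j))).add (tendsto_exp_neg_mul one_pos)
    filter_upwards [hlim.eventually (gt_mem_nhds one_pos)] with n hn
    refine (hS n i j hij).1.trans (ENNReal.ofReal_le_ofReal ?_)
    have h1 : Real.exp (-τ j) ^ ⌊(1 - 2 * η) * n⌋₊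
        ≤ Real.exp (-(ρ j * n)) * (Real.exp (τ j) * Real.exp (-(γ * n))) := by
      rw [← Real.exp_nat_mul, ← Real.exp_add, ← Real.exp_add, Real.exp_le_exp, hγ]
      have h2 := mul_le_mul_of_nonneg_left (Nat.lt_floor_add_one ((1 - 2 * η) * (n : ℝ))).le
        (hτ0 j).le
      linarith
    have h2 : θ ^ (K * n + 1) ≤ Real.exp (-(ρ j * n)) * Real.exp (-(1 * (n : ℝ))) := by
      calc θ ^ (K * n + 1) ≤ θ ^ (K * n) := pow_le_pow_of_le_one hθ0.le hθ1.le (Nat.le_succ _)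
        _ = (θ ^ K) ^ n := pow_mul _ _ _
        _ ≤ Real.exp (-μ) ^ n := pow_le_pow_left₀ (pow_nonneg hθ0.le _) hK.le _
        _ ≤ _ := by
          rw [← Real.exp_nat_mul, ← Real.exp_add, Real.exp_le_exp]
          have h3 := mul_le_mul_of_nonneg_right (hρμ j) (Nat.cast_nonneg (α := ℝ) n)
          linarith
    calc _ ≤ Real.exp (-(ρ j * n)) * (Real.exp (τ j) * Real.exp (-(γ * n)))
          + Real.exp (-(ρ j * n)) * Real.exp (-(1 * (n : ℝ))) := add_le_add h1 h2
      _ = Real.exp (-(ρ j * n)) * (Real.exp (τ j) * Real.exp (-(γ * n))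
          + Real.exp (-(1 * (n : ℝ)))) := by ring
      _ ≤ Real.exp (-(ρ j * n)) := mul_le_of_le_one_right (Real.exp_pos _).le hn.le
  · have h1 := ENNReal.tendsto_ofReal hq
    rw [ENNReal.ofReal_zero] at h1
    refine tendsto_of_tendsto_of_tendsto_of_le_of_le' tendsto_const_nhds h1
      (Eventually.of_forall fun n => zero_le) ?_
    filter_upwards [hlarge] with n hn
    refine (hS n i j hij).2.1 n ?_
    have h2 := hfl n
    have h3 : ((⌊η * n⌋₊ + ⌊(1 - 2 * η) * n⌋₊ + 1 : ℕ) : ℝ) ≤ n := by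
      push_cast
      linarith
    exact_mod_cast h3
  · have hsmall : 0 < η / (2 * (K + 2)) := by positivity
    filter_upwards [hlarge, hq.eventually (gt_mem_nhds hsmall)] with n hn hqn
    refine (hS n i j hij).2.2.trans ?_
    set q := θ ^ ⌊η * n⌋₊ + θ ^ ⌊(1 - 2 * η) * n⌋₊ with hqdef
    have hq0 : 0 ≤ q := add_nonneg (pow_nonneg hθ0.le _) (pow_nonneg hθ0.le _)
    have hn0 : (0 : ℝ) ≤ n := Nat.cast_nonneg n
    rw [← ENNReal.ofReal_natCast, ← ENNReal.ofReal_natCast, ← ENNReal.ofReal_natCast,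
      ← ENNReal.ofReal_mul (Nat.cast_nonneg _), ← ENNReal.ofReal_add (Nat.cast_nonneg _)
      (mul_nonneg (Nat.cast_nonneg _) hq0)]
    refine ENNReal.ofReal_le_ofReal ?_
    push_cast
    have h1 := hfl n
    -- a failed test costs at most `(K + 2) n` rounds
    have h2 : ((⌊η * n⌋₊ : ℕ) : ℝ) + ((⌊(1 - 2 * η) * n⌋₊ : ℕ) : ℝ) + (K * n + 1) + 1
        ≤ (K + 2) * n := by nlinarith
    have h3 : (K + 2) * n * q ≤ η / 2 * n := by
      calc (K + 2) * n * q ≤ (K + 2) * n * (η / (2 * (K + 2))) :=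
            mul_le_mul_of_nonneg_left hqn.le (by positivity)
        _ = η / 2 * n := by field_simp
    have h4 := mul_le_mul_of_nonneg_right h2 hq0
    linarith

variable {N₀ N₁ : Channel A B}

theorem coe_natCast_eq_coe_ennreal (n : ℕ) : ((n : ℝ) : EReal) = ((n : ℝ≥0∞) : EReal) := by
  rw [← ENNReal.coe_natCast, EReal.coe_nnreal_eq_coe_real, NNReal.coe_natCast]

/-- A family of pairs between the open and the closed rectangle has the closed one as closure. -/
theorem closure_eq_Icc_prod {s : Set (ℝ × ℝ)} {a b : ℝ} (ha : 0 < a) (hb : 0 < b)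
    (h1 : Set.Ioo 0 a ×ˢ Set.Ioo 0 b ⊆ s) (h2 : s ⊆ Set.Icc 0 a ×ˢ Set.Icc 0 b) :
    closure s = Set.Icc 0 a ×ˢ Set.Icc 0 b := by
  refine subset_antisymm (closure_minimal h2 (isClosed_Icc.prod isClosed_Icc)) ?_
  rw [← closure_Ioo ha.ne, ← closure_Ioo hb.ne, ← closure_prod_eq]
  exact closure_mono h1

theorem achievableP_subset {C ε : ℝ} (h : UniformlyComparable C N₀ N₁) (hε1 : ε < 1) :
    achievableP ε N₀ N₁ ⊆ Set.Icc 0 (channelMeasuredDiv N₁ N₀).toReal ×ˢ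
      Set.Icc 0 (channelMeasuredDiv N₀ N₁).toReal := by
  rintro R ⟨h0, h1, S, ⟨hR1, hR2⟩, hlim⟩
  refine ⟨⟨h0.le, ?_⟩, h1.le, ?_⟩
  · refine rate_le_of_excessProb h.symm (i := 1) (j := 0) (by decide) hε1 h1 hR1 hR2
      (lt_of_le_of_lt (limsup_le_limsup ?_) hlim)
    exact Eventually.of_forall fun n => le_max_right _ _
  · refine rate_le_of_excessProb h (i := 0) (j := 1) (by decide) hε1 h0 hR2 hR1
      (lt_of_le_of_lt (limsup_le_limsup ?_) hlim)
    exact Eventually.of_forall fun n => le_max_left _ _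

theorem achievableE_subset {C : ℝ} (h : UniformlyComparable C N₀ N₁) :
    achievableE N₀ N₁ ⊆ Set.Icc 0 (channelMeasuredDiv N₁ N₀).toReal ×ˢ
      Set.Icc 0 (channelMeasuredDiv N₀ N₁).toReal := by
  rintro R ⟨h0, h1, S, ⟨hR1, hR2⟩, hlim⟩
  have hev : ∀ᶠ n : ℕ in atTop,
      max ((S n).expectedTime N₀) ((S n).expectedTime N₁) ≤ (n : ℝ≥0∞) + 1 := by
    filter_upwards [eventually_lt_of_limsup_lt (lt_of_le_of_lt hlim zero_lt_one)] with n hn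
    rw [EReal.sub_lt_iff (Or.inl (EReal.coe_ne_bot _)) (Or.inl (EReal.coe_ne_top _))] at hn
    have h2 : (1 : EReal) + ((n : ℝ) : EReal) = (((n : ℝ≥0∞) + 1 : ℝ≥0∞) : EReal) := by
      rw [coe_natCast_eq_coe_ennreal, EReal.coe_ennreal_add, EReal.coe_ennreal_one, add_comm]
    rw [h2, EReal.coe_ennreal_lt_coe_ennreal_iff] at hn
    exact hn.le
  refine ⟨⟨h0.le, ?_⟩, h1.le, ?_⟩
  · exact rate_le_of_expectedTime h.symm (i := 1) (j := 0) (by decide) h1 hR1 hR2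
      (hev.mono fun n hn => (le_max_right _ _).trans hn)
  · exact rate_le_of_expectedTime h (i := 0) (j := 1) (by decide) h0 hR2 hR1
      (hev.mono fun n hn => (le_max_left _ _).trans hn)

theorem subset_achievable {C : ℝ} (h : UniformlyComparable C N₀ N₁) {R : ℝ × ℝ}
    (hR : R ∈ Set.Ioo 0 (channelMeasuredDiv N₁ N₀).toReal ×ˢ
      Set.Ioo 0 (channelMeasuredDiv N₀ N₁).toReal) :
    R ∈ achievableE N₀ N₁ ∧ ∀ ε : ℝ, 0 < ε → R ∈ achievableP ε N₀ N₁ := by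
  obtain ⟨⟨h1, h2⟩, h3, h4⟩ := hR
  obtain ⟨S, hS⟩ := exists_strategies (N := ![N₀, N₁]) (C := C) (ρ := ![R.2, R.1])
    (by
      intro i j hij
      fin_cases i <;> fin_cases j
      · exact absurd rfl hij
      · exact h
      · exact h.symm
      · exact absurd rfl hij)
    (by
      intro i
      fin_cases i
      · exact h3
      · exact h1)
    (by
      intro i j hij
      fin_cases i <;> fin_cases j
      · exact absurd rfl hij
      · exact h4
      · exact h2
      · exact absurd rfl hij)
  obtain ⟨e0, p0, t0⟩ := hS 0 1 (by decide)
  obtain ⟨e1, p1, t1⟩ := hS 1 0 (by decide)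
  refine ⟨⟨h1, h3, S, ⟨e0, e1⟩, ?_⟩, fun ε hε => ⟨h1, h3, S, ⟨e0, e1⟩, ?_⟩⟩
  · refine limsup_le_of_le (by isBoundedDefault) ?_
    filter_upwards [t0, t1] with n hn0 hn1
    refine EReal.sub_nonpos.2 ?_
    rw [coe_natCast_eq_coe_ennreal, EReal.coe_ennreal_le_coe_ennreal_iff]
    exact max_le hn0 hn1
  · have hmax := p0.max p1
    rw [max_self] at hmax
    exact hmax.limsup_eq.trans_lt (ENNReal.ofReal_pos.2 hε)

end Regions

end ChannelDiscrimination

open ChannelDiscrimination in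
theorem theorem1 {A B : Type*} [Fintype A] [Fintype B] [DecidableEq B]
    (N₀ N₁ : Channel A B) (hne : N₀ ≠ N₁)
    (hmax : max (channelDmax N₀ N₁) (channelDmax N₁ N₀) < ⊤)
    (ε : ℝ) (hε : 0 < ε) (hε1 : ε < 1) :
    regionP ε N₀ N₁ = regionE N₀ N₁ ∧
    regionE N₀ N₁ =
      {R : ℝ × ℝ | 0 ≤ R.1 ∧ 0 ≤ R.2 ∧
        (R.1 : EReal) ≤ (channelMeasuredDiv N₁ N₀ : EReal) ∧
        (R.2 : EReal) ≤ (channelMeasuredDiv N₀ N₁ : EReal)} := by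
  obtain ⟨C, h⟩ := exists_uniformlyComparable hmax
  obtain ⟨r, k, x, hx⟩ := exists_outProb_ne hne
  have ha := (h.symm.relEnt_pos hx.symm).trans_le (h.symm.relEnt_le x)
  have hb := (h.relEnt_pos hx).trans_le (h.relEnt_le x)
  have hP : regionP ε N₀ N₁ = _ := closure_eq_Icc_prod ha hb
    (fun R hR => (subset_achievable h hR).2 ε hε) (achievableP_subset h hε1)
  have hE : regionE N₀ N₁ = _ := closure_eq_Icc_prod ha hb
    (fun R hR => (subset_achievable h hR).1) (achievableE_subset h)
  refine ⟨hP.trans hE.symm, hE.trans ?_⟩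
  have hcoe : ∀ {D : ℝ≥0∞}, D ≠ ⊤ → ∀ t : ℝ, (t : EReal) ≤ (D : EReal) ↔ t ≤ D.toReal := by
    intro D hD t
    lift D to NNReal using hD
    rw [EReal.coe_nnreal_eq_coe_real, EReal.coe_le_coe_iff, ENNReal.coe_toReal]
  ext R
  simp only [Set.mem_prod, Set.mem_Icc, Set.mem_ofPred_eq, hcoe h.channelMeasuredDiv_ne_top,
    hcoe h.symm.channelMeasuredDiv_ne_top]
  tauto
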